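/- Let $d\ge 1$, $\alpha\in[-1/2,\infty)^d$, $\varepsilon\in\{0,1\}^d$ and $\gamma\in\mathbb{R}\setminus\{0\}$. Let $\mathbb{R}^d_+=(0,\infty)^d$, let $w_\alpha^+$ be the measure on $\mathbb{R}^d_+$ with density $\prod_{i=1}^d x_i^{2\alpha_i+1}$ with respect to Lebesgue measure, and let $B^+(x,r)=\{z\in\mathbb{R}^d_+:\|z-x\|<r\}$, where $\|\cdot\|$ is the Euclidean norm. For $t>0$ and $x,y\in\mathbb{R}^d_+$ put $$G_t^{\alpha,\varepsilon}(x,y)=\frac{1}{(2\sinh 2t)^d}\exp\Big(-\tfrac12\coth(2t)\big(\|x\|^2+\|y\|^2\big)\Big)\prod_{i=1}^d (x_iy_i)^{\varepsilon_i}\,\frac{I_{\alpha_i+\varepsilon_i}\big(\frac{x_iy_i}{\sinh 2t}\big)}{(x_iy_i)^{\alpha_i+\varepsilon_i}},$$ where $I_\nu(z)=\sum_{k=0}^\infty \frac{(z/2)^{\nu+2k}}{\Gamma(k+1)\Gamma(k+\nu+1)}$ is the modified Bessel function of the first kind, and let $$K_\gamma^{\alpha,\varepsilon}(x,y)=\frac{1}{\Gamma(i\gamma)}\int_0^\infty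 G_t^{\alpha,\varepsilon}(x,y)\,t^{i\gamma-1}\,dt .$$ Then for all $x,y\in\mathbb{R}^d_+$ with $x\ne y$ this integral converges absolutely, $K_\gamma^{\alpha,\varepsilon}$ is (real-)differentiable at $(x,y)$, and there is a constant $C>0$, independent of $x$ and $y$, such that for all $x,y\in\mathbb{R}^d_+$ with $x\neq y$ $$|K_\gamma^{\alpha,\varepsilon}(x,y)|\le \frac{C}{w_\alpha^+\big(B^+(x,\|y-x\|)\big)}$$ and $$\|\nabla_{x,y}K_\gamma^{\alpha,\varepsilon}(x,y)\|\le \frac{C}{\|x-y\|\,w_\alpha^+\big(B^+(x,\|y-x\|)\big)},$$ where $\nabla_{x,y}K$ is the vector of all $2d$ partial derivatives of $K$ in $x_1,\dots,x_d,y_1,\dots,y_d$. -/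

import Mathlib

namespace DunklHermite

noncomputable section

/-- The modified Bessel function of the first kind `I_ν(z)`, used for `z > 0` and `ν ≥ -1/2`. -/
def besselI (ν z : ℝ) : ℝ :=
  ∑' k : ℕ, (z / 2) ^ (ν + 2 * (k : ℝ)) /
    (Real.Gamma ((k : ℝ) + 1) * Real.Gamma ((k : ℝ) + ν + 1))

/-- The open orthant `ℝ^d_+ = (0, ∞)^d`. -/
def orthant (d : ℕ) : Set (EuclideanSpace ℝ (Fin d)) :=
  {x | ∀ i, 0 < x i}

/-- The weight `w_α(x) = ∏ |x_i|^(2 α_i + 1)`. -/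
def weight {d : ℕ} (α : Fin d → ℝ) (x : EuclideanSpace ℝ (Fin d)) : ℝ :=
  ∏ i, |x i| ^ (2 * α i + 1)

/-- The measure `w_α^+` on `ℝ^d_+`: density `w_α` with respect to Lebesgue measure on the orthant. -/
def weightMeasure {d : ℕ} (α : Fin d → ℝ) :
    MeasureTheory.Measure (EuclideanSpace ℝ (Fin d)) :=
  (MeasureTheory.volume.restrict (orthant d)).withDensity
    (fun x => ENNReal.ofReal (weight α x))

/-- `B^+(x, r) = B(x, r) ∩ ℝ^d_+`. -/
def orthantBall {d : ℕ} (x : EuclideanSpace ℝ (Fin d)) (r : ℝ) :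
    Set (EuclideanSpace ℝ (Fin d)) :=
  Metric.ball x r ∩ orthant d

/-- The component `G_t^{α,ε}(x, y)` of the heat kernel of the Dunkl harmonic oscillator,
for `t > 0` and `x, y` in the orthant; here `coth = cosh / sinh`. -/
def heatKernel {d : ℕ} (α : Fin d → ℝ) (ε : Fin d → Fin 2) (t : ℝ)
    (x y : EuclideanSpace ℝ (Fin d)) : ℝ :=
  1 / (2 * Real.sinh (2 * t)) ^ d *
    Real.exp (-(1 / 2) * (Real.cosh (2 * t) / Real.sinh (2 * t)) * (‖x‖ ^ 2 + ‖y‖ ^ 2)) *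
    ∏ i, ((x i * y i) ^ (ε i).val *
      (besselI (α i + ((ε i).val : ℝ)) (x i * y i / Real.sinh (2 * t)) /
        (x i * y i) ^ (α i + ((ε i).val : ℝ))))

/-- The integrand `G_t^{α,ε}(x, y) t^(iγ - 1)`. -/
def kernelIntegrand {d : ℕ} (α : Fin d → ℝ) (ε : Fin d → Fin 2) (γ : ℝ)
    (x y : EuclideanSpace ℝ (Fin d)) (t : ℝ) : ℂ :=
  (heatKernel α ε t x y : ℂ) * (t : ℂ) ^ (Complex.I * (γ : ℂ) - 1)

/-- The kernel `K_γ^{α,ε}(x, y) = Γ(iγ)⁻¹ ∫_0^∞ G_t^{α,ε}(x, y) t^(iγ - 1) dt`. -/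
def kernel {d : ℕ} (α : Fin d → ℝ) (ε : Fin d → Fin 2) (γ : ℝ)
    (x y : EuclideanSpace ℝ (Fin d)) : ℂ :=
  1 / Complex.Gamma (Complex.I * (γ : ℂ)) *
    ∫ t in Set.Ioi (0 : ℝ), kernelIntegrand α ε γ x y t

/-- `‖∇_{x,y} F(x, y)‖`: the Euclidean norm in `ℂ^{2d}` of the vector of all partial derivatives
`∂F/∂x_i`, `∂F/∂y_i`, meaningful where `F` is differentiable. -/
def gradNorm {d : ℕ} (F : EuclideanSpace ℝ (Fin d) → EuclideanSpace ℝ (Fin d) → ℂ)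
    (x y : EuclideanSpace ℝ (Fin d)) : ℝ :=
  Real.sqrt
    (∑ i, ‖fderiv ℝ (Function.uncurry F) (x, y) (EuclideanSpace.single i 1, 0)‖ ^ 2 +
     ∑ i, ‖fderiv ℝ (Function.uncurry F) (x, y) (0, EuclideanSpace.single i 1)‖ ^ 2)

end

end DunklHermite

/-! With s = sinh 2t and c = cosh 2t, the heat kernel is a product of one-dimensional factors.
Writing I_ν(z) = z^ν E_ν(z) with E_ν entire removes the apparent singularities of each factor. From
E_ν' = z E_{ν+1} and the three-term recurrence one gets the ratio bounds (z + ν + 1/2) E_{ν+1} ≤ E_ν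
≤ (z + 2ν + 2) E_{ν+1} for z ≥ 0 (`mul_besselE_succ_le`, `besselE_le_mul_succ`). The first
integrates to E_ν ≤ C e^z (1+z)^{-(ν+1/2)}. The second shows that E_ν - z E_{ν+1} is smaller than
E_ν by a factor of order 1/(1+z), which is the cancellation needed in the gradient.

Put r = ‖x - y‖. The factor e^z, z = x_i y_i / s, completes the square in the exponential, leaving
exp(-r²/(2s)) and a further decaying term in c - 1. The algebraic prefactors are at most C s^{-d/2}
∏ (x_i + r)^{-(2α_i+1)} times a power of 1 + r²/s, which the Gaussian absorbs together with the
growth produced by r∇. Hence both G_t and r‖∇G_t‖ are bounded by C W⁻¹ s (s + r²)^{-(d/2+1)}, where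
W = ∏ (x_i + r)^{2α_i+1} (`exists_heatProd_le`).

Only |t^{iγ-1}| = 1/t enters; oscillation plays no role. Since s/t ≤ 2 cosh 2t = ds/dt, the time
integral is at most ∫ (s + r²)^{-(d/2+1)} ds = (2/d) r^{-d}. Finally the ball has measure at most C
r^d W, which turns W⁻¹ r^{-d} into the claimed bound. The same majorant, made uniform near (x, y),
justifies differentiation under the integral. -/

namespace DunklHermite

noncomputable section

/-! ### Normalized Bessel functions: series, derivative, recurrence. -/

/-- The entire function `∑ u ^ k / (k! Γ(k + ν + 1))`. -/
def besselSeries (ν u : ℝ) : ℝ :=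
  ∑' k : ℕ, u ^ k / (k.factorial * Real.Gamma (k + ν + 1))

/-- The normalized modified Bessel function `z ^ (-ν) * I_ν(z)`, as an entire function of `z`. -/
def besselE (ν z : ℝ) : ℝ := 2 ^ (-ν) * besselSeries ν (z ^ 2 / 4)

/-- Each use of Γ(a+1) = aΓ(a) has a ≥ 1/2, so it loses at most a factor 2. This crude bound
suffices to dominate the series by an exponential one. -/
lemma gamma_lower_bound {ν : ℝ} (hν : -(1 / 2) ≤ ν) (k : ℕ) :
    Real.Gamma (ν + 1) / 2 ^ k ≤ Real.Gamma (k + ν + 1) := by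
  induction k with
  | zero => simp
  | succ k ih =>
    have hk : (0 : ℝ) ≤ k := Nat.cast_nonneg k
    have h0 : (k : ℝ) + ν + 1 ≠ 0 := by linarith
    have h1 : ((k + 1 : ℕ) : ℝ) + ν + 1 = ((k : ℝ) + ν + 1) + 1 := by push_cast; ring
    have hpos : 0 < Real.Gamma (k + ν + 1) := Real.Gamma_pos_of_pos (by linarith)
    rw [h1, Real.Gamma_add_one h0]
    calc Real.Gamma (ν + 1) / 2 ^ (k + 1) = (1 / 2) * (Real.Gamma (ν + 1) / 2 ^ k) := by
          rw [pow_succ]; field_simp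
      _ ≤ (1 / 2) * Real.Gamma (k + ν + 1) := by gcongr
      _ ≤ _ := by gcongr; linarith

lemma besselSeries_denom_pos {ν : ℝ} (hν : -(1 / 2) ≤ ν) (k : ℕ) :
    0 < (k.factorial : ℝ) * Real.Gamma (k + ν + 1) := by
  have hk : (0 : ℝ) ≤ k := Nat.cast_nonneg k
  exact mul_pos (by exact_mod_cast k.factorial_pos) (Real.Gamma_pos_of_pos (by linarith))

lemma summable_besselSeries {ν : ℝ} (hν : -(1 / 2) ≤ ν) (u : ℝ) :
    Summable fun k : ℕ => u ^ k / (k.factorial * Real.Gamma (k + ν + 1)) := by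
  have hG : 0 < Real.Gamma (ν + 1) := Real.Gamma_pos_of_pos (by linarith)
  refine Summable.of_norm_bounded
    (g := fun k : ℕ => (1 / Real.Gamma (ν + 1)) * ((2 * |u|) ^ k / k.factorial))
    ((Real.summable_pow_div_factorial _).mul_left _) fun k => ?_
  have hf : (0 : ℝ) < k.factorial := by exact_mod_cast k.factorial_pos
  rw [norm_div, norm_pow, Real.norm_eq_abs, Real.norm_of_nonneg (besselSeries_denom_pos hν k).le]
  calc |u| ^ k / (k.factorial * Real.Gamma (k + ν + 1))
      ≤ |u| ^ k / (k.factorial * (Real.Gamma (ν + 1) / 2 ^ k)) := by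
        gcongr
        exact gamma_lower_bound hν k
    _ = _ := by
        rw [mul_pow]; field_simp

lemma besselSeries_pos {ν u : ℝ} (hν : -(1 / 2) ≤ ν) (hu : 0 ≤ u) : 0 < besselSeries ν u := by
  refine (summable_besselSeries hν u).tsum_pos
    (fun k => div_nonneg (pow_nonneg hu k) (besselSeries_denom_pos hν k).le) 0 ?_
  exact div_pos (by simp) (besselSeries_denom_pos hν 0)

lemma succ_mul_pow_div (ν u : ℝ) (k : ℕ) :
    ((k + 1 : ℕ) : ℝ) * u ^ k / ((k + 1).factorial * Real.Gamma ((k + 1 : ℕ) + ν + 1)) =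
      u ^ k / (k.factorial * Real.Gamma (k + (ν + 1) + 1)) := by
  have hf : (k.factorial : ℝ) ≠ 0 := by exact_mod_cast k.factorial_ne_zero
  have hk : ((k : ℝ) + 1) ≠ 0 := by positivity
  rw [Nat.factorial_succ]
  push_cast
  rw [show (k : ℝ) + 1 + ν + 1 = k + (ν + 1) + 1 by ring, mul_assoc, mul_div_mul_left _ _ hk]

lemma hasDerivAt_besselSeries {ν : ℝ} (hν : -(1 / 2) ≤ ν) (u : ℝ) :
    HasDerivAt (besselSeries ν) (besselSeries (ν + 1) u) u := by
  set R : ℝ := |u| + 1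
  have hR : 0 < R := by positivity
  have hν1 : -(1 / 2) ≤ ν + 1 := by linarith
  have hshift : ∀ v : ℝ, Summable fun k : ℕ =>
      (k : ℝ) * v ^ (k - 1) / (k.factorial * Real.Gamma (k + ν + 1)) := fun v => by
    rw [← summable_nat_add_iff 1]
    refine (summable_besselSeries hν1 v).congr fun k => ?_
    rw [← succ_mul_pow_div]; simp
  have hmem : u ∈ Metric.ball (0 : ℝ) R := by simp [R]
  have key := hasDerivAt_tsum_of_isPreconnected (hshift R) Metric.isOpen_ball
    (convex_ball (0 : ℝ) R).isPreconnected
    (g := fun (k : ℕ) (v : ℝ) => v ^ k / (k.factorial * Real.Gamma (k + ν + 1)))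
    (g' := fun (k : ℕ) (v : ℝ) =>
      (k : ℝ) * v ^ (k - 1) / (k.factorial * Real.Gamma (k + ν + 1)))
    (fun k v _ => (hasDerivAt_pow k v).div_const _) (fun k v hv => by
      have hv' : |v| ≤ R := by
        have := Metric.mem_ball.mp hv
        rw [Real.dist_eq, sub_zero] at this
        exact this.le
      rw [norm_div, norm_mul, norm_pow, Real.norm_of_nonneg (besselSeries_denom_pos hν k).le,
        Real.norm_eq_abs, Real.norm_eq_abs, Nat.abs_cast]
      have := (besselSeries_denom_pos hν k).le
      gcongr) hmem (summable_besselSeries hν u) hmem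
  refine key.congr_deriv ?_
  rw [(hshift u).tsum_eq_zero_add, besselSeries]
  simp only [Nat.cast_zero, zero_mul, zero_div, zero_add]
  refine tsum_congr fun k => ?_
  rw [← succ_mul_pow_div]; simp

/-- Split k + ν + 1 = (ν + 1) + k in Γ(k+ν+2) = (k+ν+1) Γ(k+ν+1); the part carrying k is an index
shift of the series of order ν + 2. -/
lemma besselSeries_recurrence {ν : ℝ} (hν : -(1 / 2) ≤ ν) (u : ℝ) :
    besselSeries ν u = (ν + 1) * besselSeries (ν + 1) u + u * besselSeries (ν + 2) u := by
  have h1 := summable_besselSeries (show -(1 / 2) ≤ ν + 1 by linarith) u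
  have h2 := summable_besselSeries (show -(1 / 2) ≤ ν + 2 by linarith) u
  have hG : ∀ k : ℕ, Real.Gamma (k + (ν + 1) + 1) = (k + ν + 1) * Real.Gamma (k + ν + 1) :=
    fun k => by
      have hk : (0 : ℝ) ≤ k := Nat.cast_nonneg k
      rw [← Real.Gamma_add_one (by linarith)]; ring_nf
  have hpos : ∀ k : ℕ, 0 < Real.Gamma (k + ν + 1) := fun k => by
    have hk : (0 : ℝ) ≤ k := Nat.cast_nonneg k
    exact Real.Gamma_pos_of_pos (by linarith)
  have hsum : Summable fun k : ℕ =>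
      (k : ℝ) * (u ^ k / (k.factorial * Real.Gamma (k + (ν + 1) + 1))) := by
    rw [← summable_nat_add_iff 1]
    refine (h2.mul_left u).congr fun k => ?_
    rw [show ν + 2 = ν + 1 + 1 by ring, ← succ_mul_pow_div, pow_succ]; ring
  have hlast : u * besselSeries (ν + 2) u =
      ∑' k : ℕ, (k : ℝ) * (u ^ k / (k.factorial * Real.Gamma (k + (ν + 1) + 1))) := by
    rw [hsum.tsum_eq_zero_add, besselSeries, ← tsum_mul_left]
    simp only [Nat.cast_zero, zero_mul, zero_add]
    refine tsum_congr fun k => ?_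
    rw [show ν + 2 = ν + 1 + 1 by ring, ← succ_mul_pow_div, pow_succ]; ring
  rw [hlast, besselSeries, besselSeries, ← tsum_mul_left, ← (h1.mul_left _).tsum_add hsum]
  refine tsum_congr fun k => ?_
  have hk : (0 : ℝ) ≤ k := Nat.cast_nonneg k
  have hf : (k.factorial : ℝ) ≠ 0 := by exact_mod_cast k.factorial_ne_zero
  have hk' : (k : ℝ) + ν + 1 ≠ 0 := by linarith
  rw [hG k]
  have := (hpos k).ne'
  field_simp
  ring

lemma besselE_pos {ν : ℝ} (hν : -(1 / 2) ≤ ν) (z : ℝ) : 0 < besselE ν z :=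
  mul_pos (by positivity) (besselSeries_pos hν (by positivity))

lemma two_rpow_neg_add_one (ν : ℝ) : (2 : ℝ) ^ (-(ν + 1)) = 2 ^ (-ν) / 2 := by
  rw [neg_add, Real.rpow_add two_pos, Real.rpow_neg_one]; ring

lemma hasDerivAt_besselE {ν : ℝ} (hν : -(1 / 2) ≤ ν) (z : ℝ) :
    HasDerivAt (besselE ν) (z * besselE (ν + 1) z) z := by
  have h1 : HasDerivAt (fun z : ℝ => z ^ 2 / 4) (z / 2) z := by
    refine ((hasDerivAt_pow 2 z).div_const 4).congr_deriv ?_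
    norm_num; ring
  have h2 := ((hasDerivAt_besselSeries hν (z ^ 2 / 4)).comp z h1).const_mul (2 ^ (-ν))
  refine h2.congr_deriv ?_
  rw [besselE, two_rpow_neg_add_one]; ring

lemma continuous_besselE {ν : ℝ} (hν : -(1 / 2) ≤ ν) : Continuous (besselE ν) :=
  continuous_iff_continuousAt.mpr fun z => (hasDerivAt_besselE hν z).continuousAt

lemma besselE_recurrence {ν : ℝ} (hν : -(1 / 2) ≤ ν) (z : ℝ) :
    besselE ν z = (2 * ν + 2) * besselE (ν + 1) z + z ^ 2 * besselE (ν + 2) z := by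
  simp only [besselE]
  rw [besselSeries_recurrence hν, show ν + 2 = ν + 1 + 1 by ring, two_rpow_neg_add_one (ν + 1),
    two_rpow_neg_add_one ν]
  ring

lemma besselI_eq (ν : ℝ) {z : ℝ} (hz : 0 < z) : besselI ν z = z ^ ν * besselE ν z := by
  rw [besselI, besselE, besselSeries, ← tsum_mul_left, ← tsum_mul_left]
  refine tsum_congr fun k => ?_
  rw [Real.rpow_add (by positivity), Real.div_rpow hz.le two_pos.le, Real.rpow_neg two_pos.le,
    Real.Gamma_nat_eq_factorial, Real.rpow_mul (by positivity), Real.rpow_natCast]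
  rw [show (z / 2) ^ (2 : ℝ) = z ^ 2 / 4 by
    rw [Real.rpow_two]; ring]
  ring

/-! ### Ratio bounds and exponential growth of the Bessel functions. -/

/-- A differential inequality `z D' + (z + p) D ≥ 0` propagates nonnegativity from `0`. -/
lemma nonneg_of_mul_deriv_add_nonneg {D D' : ℝ → ℝ} {p : ℝ} (hp : 0 ≤ p)
    (hD : ∀ z, HasDerivAt D (D' z) z) (h0 : 0 ≤ D 0)
    (h : ∀ z, 0 < z → 0 ≤ z * D' z + (z + p) * D z) {z : ℝ} (hz : 0 ≤ z) : 0 ≤ D z := by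
  have hcont : Continuous D := continuous_iff_continuousAt.mpr fun z => (hD z).continuousAt
  -- The integrating factor of the inequality is z^p e^z.
  have hmono : MonotoneOn (fun z => z ^ p * Real.exp z * D z) (Set.Ici 0) := by
    refine monotoneOn_of_hasDerivWithinAt_nonneg (convex_Ici 0)
      (f' := fun z => z ^ (p - 1) * Real.exp z * (z * D' z + (z + p) * D z)) ?_ ?_ ?_
    · exact ((((Real.continuous_rpow_const hp).mul Real.continuous_exp).mul hcont)).continuousOn
    · intro w hw
      rw [interior_Ici] at hw
      have hw0 : 0 < w := hw
      refine HasDerivAt.hasDerivWithinAt ?_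
      refine (((Real.hasDerivAt_rpow_const (p := p) (Or.inl hw0.ne')).mul
        (Real.hasDerivAt_exp w)).mul (hD w)).congr_deriv ?_
      have : w ^ p = w ^ (p - 1) * w := by
        rw [← Real.rpow_add_one hw0.ne']; ring_nf
      simp only [Pi.mul_apply]
      rw [this]; ring
    · intro w hw
      rw [interior_Ici] at hw
      have hw0 : 0 < w := hw
      have := h w hw0
      positivity
  rcases hz.eq_or_lt with rfl | hz0
  · exact h0
  have h1 := hmono Set.self_mem_Ici hz hz
  have h2 : 0 ≤ z ^ p * Real.exp z * D z := le_trans (by positivity) h1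
  exact nonneg_of_mul_nonneg_right h2 (by positivity)

lemma hasDerivAt_mul_besselE_succ {ν : ℝ} (hν : -(1 / 2) ≤ ν) (z κ : ℝ) :
    HasDerivAt (fun w => (w + κ) * besselE (ν + 1) w)
      (besselE (ν + 1) z + (z + κ) * (z * besselE (ν + 2) z)) z := by
  have h := ((hasDerivAt_id z).add_const κ).mul
    (hasDerivAt_besselE (show -(1 / 2) ≤ ν + 1 by linarith) z)
  refine h.congr_deriv ?_
  rw [show ν + 1 + 1 = ν + 2 by ring]; simp

/-- Upper bound on the ratio `I_{ν+1} / I_ν`. -/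
lemma mul_besselE_succ_le {ν z : ℝ} (hν : -(1 / 2) ≤ ν) (hz : 0 ≤ z) :
    (z + (ν + 1 / 2)) * besselE (ν + 1) z ≤ besselE ν z := by
  rw [← sub_nonneg]
  -- With p equal to the shift in D, the recurrence eliminates the orders ν and ν + 2, leaving a
  -- polynomial times E_{ν+1}. The shift ν + 1/2 is the one that cancels its linear term.
  refine nonneg_of_mul_deriv_add_nonneg (p := ν + 1 / 2) (by linarith)
    (D := fun z => besselE ν z - (z + (ν + 1 / 2)) * besselE (ν + 1) z)
    (fun w => (hasDerivAt_besselE hν w).sub (hasDerivAt_mul_besselE_succ hν w _)) ?_ ?_ hz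
  · have hrec := besselE_recurrence hν 0
    have h1 := besselE_pos (show -(1 / 2) ≤ ν + 1 by linarith) 0
    rw [hrec]; nlinarith
  · intro w hw
    have hrec := besselE_recurrence hν w
    have h1 := besselE_pos (show -(1 / 2) ≤ ν + 1 by linarith) w
    have : 0 ≤ (ν + 1 / 2) * (ν + 3 / 2) * besselE (ν + 1) w :=
      mul_nonneg (mul_nonneg (by linarith) (by linarith)) h1.le
    refine this.trans_eq ?_
    rw [hrec]; ring

/-- Lower bound on the ratio `I_{ν+1} / I_ν`. -/
lemma besselE_le_mul_succ {ν z : ℝ} (hν : -(1 / 2) ≤ ν) (hz : 0 ≤ z) :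
    besselE ν z ≤ (z + (2 * ν + 2)) * besselE (ν + 1) z := by
  rw [← sub_nonneg]
  -- The shift 2ν + 2 is the value of the ratio at 0, so that D vanishes there by the recurrence.
  refine nonneg_of_mul_deriv_add_nonneg (p := 2 * ν + 2) (by linarith)
    (D := fun z => (z + (2 * ν + 2)) * besselE (ν + 1) z - besselE ν z)
    (fun w => (hasDerivAt_mul_besselE_succ hν w _).sub (hasDerivAt_besselE hν w)) ?_ ?_ hz
  · have hrec := besselE_recurrence hν 0
    rw [hrec]; simp
  · intro w hw
    have hrec := besselE_recurrence hν w
    have h1 := besselE_pos (show -(1 / 2) ≤ ν + 1 by linarith) w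
    have : 0 ≤ (2 * ν + 3) * w * besselE (ν + 1) w :=
      mul_nonneg (mul_nonneg (by linarith) hw.le) h1.le
    refine this.trans_eq ?_
    rw [hrec]; ring

/-- The upper ratio bound makes (z + a + 1)^a e^{-z} E_ν(z), a = ν + 1/2, decreasing, so its value
at 0 is a bound. The shift a + 1 is suited to the identity (w + 1)(w + a) = w(w + a + 1) + a. -/
lemma exists_besselE_le {ν : ℝ} (hν : -(1 / 2) ≤ ν) :
    ∃ C : ℝ, 0 < C ∧ ∀ z, 0 ≤ z →
      besselE ν z ≤ C * Real.exp z * (1 + z) ^ (-(ν + 1 / 2)) := by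
  set a : ℝ := ν + 1 / 2
  have ha : 0 ≤ a := by simp only [a]; linarith
  have hanti : AntitoneOn (fun z => (z + (a + 1)) ^ a * Real.exp (-z) * besselE ν z)
      (Set.Ici 0) := by
    have hder : ∀ w : ℝ, 0 ≤ w →
        HasDerivAt (fun z => (z + (a + 1)) ^ a * Real.exp (-z) * besselE ν z)
          ((w + (a + 1)) ^ (a - 1) * Real.exp (-w) *
            ((w + (a + 1)) * w * besselE (ν + 1) w - (w + 1) * besselE ν w)) w := by
      intro w hw
      have hb : 0 < w + (a + 1) := by linarith
      refine (((((hasDerivAt_id w).add_const (a + 1)).rpow_const (p := a) (Or.inl hb.ne')).mul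
        ((hasDerivAt_neg w).exp)).mul (hasDerivAt_besselE hν w)).congr_deriv ?_
      have : (w + (a + 1)) ^ a = (w + (a + 1)) ^ (a - 1) * (w + (a + 1)) := by
        rw [← Real.rpow_add_one hb.ne']; ring_nf
      simp only [Pi.mul_apply, id]
      rw [this]; ring
    refine antitoneOn_of_hasDerivWithinAt_nonpos (convex_Ici 0)
      (fun w hw => (hder w hw).continuousAt.continuousWithinAt)
      (fun w hw => (hder w (interior_subset hw)).hasDerivWithinAt) ?_
    intro w hw
    have hw0 : 0 ≤ w := interior_subset hw
    have h1 := mul_besselE_succ_le hν hw0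
    have h2 := besselE_pos (show -(1 / 2) ≤ ν + 1 by linarith) w
    refine mul_nonpos_of_nonneg_of_nonpos (by positivity) ?_
    change (w + a) * besselE (ν + 1) w ≤ _ at h1
    have h3 : (w + 1) * ((w + a) * besselE (ν + 1) w) ≤ (w + 1) * besselE ν w := by gcongr
    nlinarith [mul_nonneg ha h2.le]
  refine ⟨(a + 1) ^ a * besselE ν 0, mul_pos (by positivity) (besselE_pos hν 0), fun z hz => ?_⟩
  have h := hanti Set.self_mem_Ici hz hz
  simp only [zero_add, neg_zero, Real.exp_zero, mul_one] at h
  have hE := (besselE_pos hν z).le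
  have h1 : (1 + z) ^ a * (Real.exp (-z) * besselE ν z) ≤ (a + 1) ^ a * besselE ν 0 := by
    refine le_trans ?_ h
    rw [mul_assoc]
    have : 1 + z ≤ z + (a + 1) := by linarith
    gcongr
  rw [Real.rpow_neg (by positivity), ← div_eq_mul_inv, le_div_iff₀ (by positivity)]
  calc besselE ν z * (1 + z) ^ a
      = Real.exp z * ((1 + z) ^ a * (Real.exp (-z) * besselE ν z)) := by
        rw [Real.exp_neg]; field_simp
    _ ≤ Real.exp z * ((a + 1) ^ a * besselE ν 0) := by gcongr
    _ = _ := by ring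

/-! ### Gaussian bounds for the one-dimensional factor and its derivative. -/

/-- The one-dimensional factor of the heat kernel, with `s = sinh 2t` and `c = cosh 2t`. -/
def heatFactor (α : ℝ) (e : ℕ) (s c x y : ℝ) : ℝ :=
  1 / 2 * s ^ (-(1 + α)) * Real.exp (-(1 / 2) * (c / s) * (x ^ 2 + y ^ 2)) *
    ((x * y / s) ^ e * besselE (α + e) (x * y / s))

/-- The partial derivative of `heatFactor` in `x`; by symmetry, also that in `y`. -/
def heatFactorDeriv (α : ℝ) (e : ℕ) (s c x y : ℝ) : ℝ :=
  1 / 2 * s ^ (-(1 + α)) * Real.exp (-(1 / 2) * (c / s) * (x ^ 2 + y ^ 2)) *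
    (e * (x * y / s) ^ (e - 1) * (y / s) * besselE (α + e) (x * y / s) +
      (x * y / s) ^ e * (-(c / s) * x * besselE (α + e) (x * y / s) +
        y / s * (x * y / s * besselE (α + e + 1) (x * y / s))))

/-- The Gaussian majorant of `heatFactor`. -/
def heatFactorBound (α s c x y : ℝ) : ℝ :=
  s ^ (-(1 + α)) * (1 + x * y / s) ^ (-(α + 1 / 2)) *
    Real.exp (-((x - y) ^ 2 / (2 * s)) - (c - 1) / (2 * s) * (x ^ 2 + y ^ 2))

lemma heatFactorBound_comm (α s c x y : ℝ) :
    heatFactorBound α s c x y = heatFactorBound α s c y x := by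
  simp only [heatFactorBound]
  rw [mul_comm x y, add_comm (x ^ 2), ← neg_sub y x, neg_sq]

lemma heatFactorBound_nonneg {α s c x y : ℝ} (hs : 0 < s) (hx : 0 < x) (hy : 0 < y) :
    0 ≤ heatFactorBound α s c x y := by
  unfold heatFactorBound; positivity

lemma hasFDerivAt_heatFactor {E : Type*} [NormedAddCommGroup E] [NormedSpace ℝ E]
    {α : ℝ} (hα : -(1 / 2) ≤ α) (e : ℕ) (s c : ℝ) {X Y : E → ℝ} {X' Y' : E →L[ℝ] ℝ} {p : E}
    (hX : HasFDerivAt X X' p) (hY : HasFDerivAt Y Y' p) :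
    HasFDerivAt (fun q => heatFactor α e s c (X q) (Y q))
      (heatFactorDeriv α e s c (X p) (Y p) • X' + heatFactorDeriv α e s c (Y p) (X p) • Y') p := by
  have hν : -(1 / 2) ≤ α + e := by
    have : (0 : ℝ) ≤ e := Nat.cast_nonneg e
    linarith
  have hz : HasFDerivAt (fun q => X q * Y q / s) (s⁻¹ • (X p • Y' + Y p • X')) p := by
    simpa [div_eq_mul_inv] using (hX.mul hY).mul_const s⁻¹
  have hexp : HasFDerivAt
      (fun q => Real.exp (-(1 / 2) * (c / s) * (X q ^ 2 + Y q ^ 2))) _ p :=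
    (((hX.pow 2).add (hY.pow 2)).const_mul (-(1 / 2) * (c / s))).exp
  have hpow := (hasDerivAt_pow e (X p * Y p / s)).comp_hasFDerivAt p hz
  have hE := (hasDerivAt_besselE hν (X p * Y p / s)).comp_hasFDerivAt p hz
  have h := (hexp.const_mul (1 / 2 * s ^ (-(1 + α)))).mul (hpow.mul hE)
  refine h.congr_fderiv ?_
  ext v
  simp only [Pi.mul_apply, Function.comp_apply, add_apply, Pi.add_apply,
    smul_apply, smul_eq_mul, heatFactorDeriv, nsmul_eq_mul]
  rw [mul_comm (Y p) (X p), add_comm (Y p ^ 2) (X p ^ 2)]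
  push_cast
  simp only [div_eq_mul_inv, pow_one]
  ring

lemma one_add_rpow_split {z : ℝ} (hz : 0 ≤ z) (a : ℝ) (e : ℕ) :
    (1 + z) ^ (-(a + e + 1 / 2)) * (1 + z) ^ e = (1 + z) ^ (-(a + 1 / 2)) := by
  rw [← Real.rpow_natCast, ← Real.rpow_add (by positivity)]
  ring_nf

lemma exp_heat_identity {s : ℝ} (hs : 0 < s) (c x y : ℝ) :
    Real.exp (-(1 / 2) * (c / s) * (x ^ 2 + y ^ 2)) * Real.exp (x * y / s) =
      Real.exp (-((x - y) ^ 2 / (2 * s)) - (c - 1) / (2 * s) * (x ^ 2 + y ^ 2)) := by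
  rw [← Real.exp_add]
  congr 1
  field_simp
  ring

/-- These are the three Bessel expressions occurring in the factor and its derivative. The last two
gain a factor 1/(1+z): one by losing a power of z, the other through the cancellation in E_ν - z
E_{ν+1}, measured by the lower ratio bound. -/
lemma exists_pow_mul_besselE_le {α : ℝ} (hα : -(1 / 2) ≤ α) (e : ℕ) :
    ∃ C : ℝ, 0 < C ∧ ∀ z, 0 ≤ z →
      z ^ e * besselE (α + e) z ≤ C * (Real.exp z * (1 + z) ^ (-(α + 1 / 2))) ∧
      e * z ^ (e - 1) * besselE (α + e) z * (1 + z) ≤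
        C * (Real.exp z * (1 + z) ^ (-(α + 1 / 2))) ∧
      z ^ e * (besselE (α + e) z - z * besselE (α + e + 1) z) * (1 + z) ≤
        C * (Real.exp z * (1 + z) ^ (-(α + 1 / 2))) := by
  have he : (0 : ℝ) ≤ e := Nat.cast_nonneg e
  have hν : -(1 / 2) ≤ α + e := by linarith
  have hν1 : -(1 / 2) ≤ α + e + 1 := by linarith
  obtain ⟨C₁, hC₁, h₁⟩ := exists_besselE_le hν
  obtain ⟨C₂, hC₂, h₂⟩ := exists_besselE_le hν1
  have hm : 0 < 2 * (α + e) + 2 := by linarith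
  refine ⟨C₁ + e * C₁ + (2 * (α + e) + 2) * C₂, by positivity, fun z hz => ?_⟩
  have hB : 0 ≤ Real.exp z * (1 + z) ^ (-(α + 1 / 2)) := by positivity
  have hE := (besselE_pos hν z).le
  have hz1 : z ^ e ≤ (1 + z) ^ e := by gcongr; linarith
  have hP : besselE (α + e) z * (1 + z) ^ e ≤ C₁ * (Real.exp z * (1 + z) ^ (-(α + 1 / 2))) := by
    calc besselE (α + e) z * (1 + z) ^ e
        ≤ C₁ * Real.exp z * (1 + z) ^ (-(α + e + 1 / 2)) * (1 + z) ^ e := by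
          gcongr; exact h₁ z hz
      _ = _ := by rw [mul_assoc, one_add_rpow_split hz]; ring
  have hsucc : besselE (α + e + 1) z * (1 + z) ^ (e + 1) ≤
      C₂ * (Real.exp z * (1 + z) ^ (-(α + 1 / 2))) := by
    calc besselE (α + e + 1) z * (1 + z) ^ (e + 1)
        ≤ C₂ * Real.exp z * (1 + z) ^ (-(α + e + 1 + 1 / 2)) * (1 + z) ^ (e + 1) := by
          gcongr; exact h₂ z hz
      _ = _ := by
          have := one_add_rpow_split hz α (e + 1)
          push_cast at this
          rw [mul_assoc, add_assoc α, this]; ring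
  have hC2' : 0 ≤ (2 * (α + e) + 2) * C₂ := by positivity
  have heC : 0 ≤ e * C₁ := by positivity
  refine ⟨?_, ?_, ?_⟩
  · calc z ^ e * besselE (α + e) z ≤ (1 + z) ^ e * besselE (α + e) z := by gcongr
      _ ≤ C₁ * (Real.exp z * (1 + z) ^ (-(α + 1 / 2))) := by rw [mul_comm]; exact hP
      _ ≤ _ := by gcongr; linarith
  · have h3 : e * z ^ (e - 1) * (1 + z) ≤ e * (1 + z) ^ e := by
      -- For e = 0 the truncated exponent e - 1 is harmless, since the coefficient e vanishes.
      rcases e with _ | n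
      · simp
      · rw [Nat.add_sub_cancel, pow_succ, mul_assoc]
        gcongr; linarith
    calc e * z ^ (e - 1) * besselE (α + e) z * (1 + z)
        = e * z ^ (e - 1) * (1 + z) * besselE (α + e) z := by ring
      _ ≤ e * (1 + z) ^ e * besselE (α + e) z := by gcongr
      _ = e * (besselE (α + e) z * (1 + z) ^ e) := by ring
      _ ≤ e * (C₁ * (Real.exp z * (1 + z) ^ (-(α + 1 / 2)))) := by gcongr
      _ = e * C₁ * (Real.exp z * (1 + z) ^ (-(α + 1 / 2))) := by ring
      _ ≤ _ := by gcongr; linarith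
  · have h4 : besselE (α + e) z - z * besselE (α + e + 1) z ≤
        (2 * (α + e) + 2) * besselE (α + e + 1) z := by
      have := besselE_le_mul_succ hν hz
      linarith
    have hE1 := (besselE_pos hν1 z).le
    calc z ^ e * (besselE (α + e) z - z * besselE (α + e + 1) z) * (1 + z)
        ≤ z ^ e * ((2 * (α + e) + 2) * besselE (α + e + 1) z) * (1 + z) := by gcongr
      _ ≤ (1 + z) ^ e * ((2 * (α + e) + 2) * besselE (α + e + 1) z) * (1 + z) := by gcongr
      _ = (2 * (α + e) + 2) * (besselE (α + e + 1) z * (1 + z) ^ (e + 1)) := by ring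
      _ ≤ (2 * (α + e) + 2) * (C₂ * (Real.exp z * (1 + z) ^ (-(α + 1 / 2)))) := by gcongr
      _ = (2 * (α + e) + 2) * C₂ * (Real.exp z * (1 + z) ^ (-(α + 1 / 2))) := by ring
      _ ≤ _ := by gcongr; linarith

lemma exists_heatFactor_le {α : ℝ} (hα : -(1 / 2) ≤ α) (e : ℕ) :
    ∃ C : ℝ, 0 < C ∧ ∀ s c x y : ℝ, 0 < s → 1 ≤ c → 0 < x → 0 < y →
      |heatFactor α e s c x y| ≤ C * heatFactorBound α s c x y ∧
      |heatFactorDeriv α e s c x y| ≤ C * heatFactorBound α s c x y *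
        (y / s / (1 + x * y / s) + |x - y| / s + (c - 1) / s * x) := by
  obtain ⟨C, hC, hb⟩ := exists_pow_mul_besselE_le hα e
  have he : (0 : ℝ) ≤ e := Nat.cast_nonneg e
  have hν : -(1 / 2) ≤ α + e := by linarith
  refine ⟨C, hC, fun s c x y hs hc hx hy => ?_⟩
  set z := x * y / s with hz
  have hz0 : 0 < z := by positivity
  obtain ⟨h1, h2, h3⟩ := hb z hz0.le
  set B := Real.exp z * (1 + z) ^ (-(α + 1 / 2)) with hB
  have hB0 : 0 ≤ B := by positivity
  set P := 1 / 2 * s ^ (-(1 + α)) * Real.exp (-(1 / 2) * (c / s) * (x ^ 2 + y ^ 2)) with hP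
  have hP0 : 0 ≤ P := by positivity
  have hPB : P * B = 1 / 2 * heatFactorBound α s c x y := by
    rw [heatFactorBound, ← exp_heat_identity hs, ← hz]; ring
  have hE := (besselE_pos hν z).le
  have hE1 := (besselE_pos (show -(1 / 2) ≤ α + e + 1 by linarith) z).le
  have hdiff : 0 ≤ besselE (α + e) z - z * besselE (α + e + 1) z := by
    have h4 := mul_besselE_succ_le hν hz0.le
    have h5 : 0 ≤ (α + e + 1 / 2) * besselE (α + e + 1) z := mul_nonneg (by linarith) hE1
    linarith
  have hbd := heatFactorBound_nonneg (α := α) (c := c) hs hx hy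
  constructor
  · have h0 : 0 ≤ heatFactor α e s c x y := by
      unfold heatFactor; rw [← hz]; positivity
    rw [abs_of_nonneg h0]
    calc heatFactor α e s c x y = P * (z ^ e * besselE (α + e) z) := rfl
      _ ≤ P * (C * B) := by gcongr
      _ = C * (P * B) := by ring
      _ ≤ _ := by rw [hPB]; gcongr; linarith
  · set w := y / s / (1 + z) with hw
    have hz1 : 0 < 1 + z := by positivity
    have hws : y / s = w * (1 + z) := by rw [hw]; field_simp
    have hw0 : 0 ≤ w := by positivity
    have hcx : |(y - c * x) / s| ≤ |x - y| / s + (c - 1) / s * x := by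
      rw [abs_div, abs_of_pos hs, show (c - 1) / s * x = (c - 1) * x / s by ring, ← add_div]
      gcongr
      have : |y - c * x| ≤ |-(x - y)| + |-((c - 1) * x)| := by
        refine le_trans (le_of_eq ?_) (abs_add_le _ _)
        congr 1; ring
      rwa [abs_neg, abs_neg, abs_of_nonneg (mul_nonneg (by linarith : (0 : ℝ) ≤ c - 1) hx.le)]
        at this
    -- The regrouping adds and subtracts (y/s) E_ν. Of the two large terms there remain (y - cx)/s,
    -- small when x is near y and c near 1, and (y/s)(E_ν - z E_{ν+1}), where 1/(1+z) is gained.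
    have heq : heatFactorDeriv α e s c x y =
        P * (w * (e * z ^ (e - 1) * besselE (α + e) z * (1 + z)) +
          (y - c * x) / s * (z ^ e * besselE (α + e) z) -
          w * (z ^ e * (besselE (α + e) z - z * besselE (α + e + 1) z) * (1 + z))) := by
      rw [heatFactorDeriv, ← hz, ← hP]
      congr 1
      rw [hws, show -(c / s) * x = (y - c * x) / s - y / s by ring, hws]
      ring
    have hA1 : 0 ≤ e * z ^ (e - 1) * besselE (α + e) z * (1 + z) := by positivity
    have hA2 : 0 ≤ z ^ e * besselE (α + e) z := by positivity
    have hA3 : 0 ≤ z ^ e * (besselE (α + e) z - z * besselE (α + e + 1) z) * (1 + z) := by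
      positivity
    have hr0 : 0 ≤ |x - y| / s + (c - 1) / s * x := (abs_nonneg _).trans hcx
    rw [heq, abs_mul, abs_of_nonneg hP0]
    calc _ ≤ P * (w * (C * B) + (|x - y| / s + (c - 1) / s * x) * (C * B) + w * (C * B)) := by
          gcongr
          refine (abs_sub _ _).trans (add_le_add ((abs_add_le _ _).trans (add_le_add ?_ ?_)) ?_)
          · rw [abs_of_nonneg (by positivity)]; gcongr
          · rw [abs_mul, abs_of_nonneg hA2]; gcongr
          · rw [abs_of_nonneg (by positivity)]; gcongr
      _ = C * (P * B) * (2 * w + (|x - y| / s + (c - 1) / s * x)) := by ring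
      _ ≤ C * (P * B) * (2 * (w + |x - y| / s + (c - 1) / s * x)) := by
          gcongr; linarith
      _ = _ := by rw [hPB]; ring

/-- From |x - y| ≤ r follows y² ≤ 2xy + r², hence ry ≤ (r² + y²)/2 ≤ r² + xy. -/
lemma div_div_one_add_le {s x y r : ℝ} (hs : 0 < s) (hx : 0 < x) (hy : 0 < y)
    (hr : |x - y| ≤ r) : r * (y / s / (1 + x * y / s)) ≤ 2 * (1 + r ^ 2 / s) := by
  have hr0 : 0 ≤ r := (abs_nonneg _).trans hr
  have hsq : (x - y) ^ 2 ≤ r ^ 2 := sq_le_sq' (abs_le.mp hr).1 (abs_le.mp hr).2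
  have hy2 : y ^ 2 ≤ 2 * (x * y) + r ^ 2 := by nlinarith
  rw [show y / s / (1 + x * y / s) = y / (s + x * y) by field_simp, ← mul_div_assoc,
    show 2 * (1 + r ^ 2 / s) = 2 * (s + r ^ 2) / s by field_simp, div_le_div_iff₀ (by positivity) hs]
  have h1 : 0 ≤ x * y := by positivity
  have h2 : r * y ≤ r ^ 2 + x * y := by
    nlinarith [sq_nonneg (r - y)]
  calc r * y * s ≤ (r ^ 2 + x * y) * s := by gcongr
    _ ≤ _ := by nlinarith [mul_nonneg h1 hs.le, mul_nonneg h1 (sq_nonneg r), mul_nonneg hs.le (sq_nonneg r)]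

/-- Since x² ≤ 2xy + r², one has (x + r)² ≤ 4(xy + r²) ≤ 4(1 + r²/s)(s + xy); this is raised to the
power α + 1/2 ≥ 0. It trades the product xy for the quantity x + r that governs the weight on the
ball. -/
lemma heatFactorBound_prefactor_le {α s x y r : ℝ} (hα : -(1 / 2) ≤ α) (hs : 0 < s) (hx : 0 < x)
    (hy : 0 < y) (hr : |x - y| ≤ r) :
    s ^ (-(1 + α)) * (1 + x * y / s) ^ (-(α + 1 / 2)) ≤
      4 ^ (α + 1 / 2) * s ^ (-(1 / 2) : ℝ) * ((x + r) ^ (2 * α + 1))⁻¹ *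
        (1 + r ^ 2 / s) ^ (α + 1 / 2) := by
  have hr0 : 0 ≤ r := (abs_nonneg _).trans hr
  have ha : 0 ≤ α + 1 / 2 := by linarith
  have hsq : (x - y) ^ 2 ≤ r ^ 2 := sq_le_sq' (abs_le.mp hr).1 (abs_le.mp hr).2
  have hkey : (x + r) ^ 2 ≤ 4 * (1 + r ^ 2 / s) * (s * (1 + x * y / s)) := by
    have h1 : (x + r) ^ 2 ≤ 4 * (x * y) + 4 * r ^ 2 := by
      nlinarith [sq_nonneg (x - r), sq_nonneg y]
    have h2 : 4 * (1 + r ^ 2 / s) * (s * (1 + x * y / s)) =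
        4 * (x * y) + 4 * r ^ 2 + 4 * s + 4 * (r ^ 2 / s * (x * y)) := by
      field_simp; ring
    have h3 : 0 ≤ r ^ 2 / s * (x * y) := by positivity
    linarith
  have hpow : (x + r) ^ (2 * α + 1) ≤
      4 ^ (α + 1 / 2) * (1 + r ^ 2 / s) ^ (α + 1 / 2) *
        (s ^ (α + 1 / 2) * (1 + x * y / s) ^ (α + 1 / 2)) := by
    have h1 : (x + r) ^ (2 * α + 1) = ((x + r) ^ 2) ^ (α + 1 / 2) := by
      rw [← Real.rpow_natCast, ← Real.rpow_mul (by positivity)]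
      congr 1; push_cast; ring
    rw [h1, ← Real.mul_rpow (by positivity) (by positivity),
      ← Real.mul_rpow (by positivity) (by positivity),
      ← Real.mul_rpow (by positivity) (by positivity)]
    exact Real.rpow_le_rpow (by positivity) hkey ha
  rw [show -(1 + α) = -(1 / 2) + -(α + 1 / 2) by ring, Real.rpow_add hs,
    Real.rpow_neg hs.le (α + 1 / 2), Real.rpow_neg (by positivity) (α + 1 / 2)]
  have hX : 0 < (x + r) ^ (2 * α + 1) := by positivity
  have hS : 0 < s ^ (α + 1 / 2) * (1 + x * y / s) ^ (α + 1 / 2) := by positivity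
  calc s ^ (-(1 / 2) : ℝ) * (s ^ (α + 1 / 2))⁻¹ * ((1 + x * y / s) ^ (α + 1 / 2))⁻¹
      = s ^ (-(1 / 2) : ℝ) * (s ^ (α + 1 / 2) * (1 + x * y / s) ^ (α + 1 / 2))⁻¹ := by
        rw [mul_inv, mul_assoc]
    _ ≤ s ^ (-(1 / 2) : ℝ) * (4 ^ (α + 1 / 2) * (1 + r ^ 2 / s) ^ (α + 1 / 2) *
          ((x + r) ^ (2 * α + 1))⁻¹) := by
        gcongr
        rw [inv_eq_one_div, div_le_iff₀ hS, ← div_eq_mul_inv, div_mul_eq_mul_div, one_le_div hX]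
        exact hpow
    _ = _ := by ring

lemma exists_one_add_rpow_mul_exp_le (p : ℝ) :
    ∃ C : ℝ, 0 < C ∧ ∀ u : ℝ, 0 ≤ u → (1 + u) ^ p * Real.exp (-(u / 2)) ≤ C := by
  obtain ⟨n, hn⟩ := exists_nat_ge p
  refine ⟨2 ^ n * n.factorial * Real.exp (1 / 2), by positivity, fun u hu => ?_⟩
  have h1 := Real.pow_div_factorial_le_exp ((1 + u) / 2) (by positivity) n
  have hf : (0 : ℝ) < n.factorial := by exact_mod_cast n.factorial_pos
  rw [div_le_iff₀ hf, div_pow, div_le_iff₀ (by positivity)] at h1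
  calc (1 + u) ^ p * Real.exp (-(u / 2)) ≤ (1 + u) ^ n * Real.exp (-(u / 2)) := by
        gcongr
        rw [← Real.rpow_natCast]
        exact Real.rpow_le_rpow_of_exponent_le (by linarith) hn
    _ ≤ Real.exp ((1 + u) / 2) * n.factorial * 2 ^ n * Real.exp (-(u / 2)) := by gcongr
    _ = 2 ^ n * n.factorial * (Real.exp ((1 + u) / 2) * Real.exp (-(u / 2))) := by ring
    _ = _ := by
        rw [← Real.exp_add]; ring_nf

/-! ### The d-dimensional product and its derivative. -/

variable {d : ℕ}

/-- The product `∏ (x_i + r) ^ (2 α_i + 1)`, which dominates the weight on `B(x, r)`. -/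
def shiftedWeight (α : Fin d → ℝ) (x : EuclideanSpace ℝ (Fin d)) (r : ℝ) : ℝ :=
  ∏ i, (x i + r) ^ (2 * α i + 1)

lemma shiftedWeight_pos (α : Fin d → ℝ) {x : EuclideanSpace ℝ (Fin d)} (hx : x ∈ orthant d)
    {r : ℝ} (hr : 0 ≤ r) : 0 < shiftedWeight α x r :=
  Finset.prod_pos fun i _ => Real.rpow_pos_of_pos (add_pos_of_pos_of_nonneg (hx i) hr) _

lemma abs_sub_apply_le (x y : EuclideanSpace ℝ (Fin d)) (i : Fin d) : |x i - y i| ≤ ‖x - y‖ := by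
  simpa using PiLp.norm_apply_le (x - y) i

lemma prod_heatFactorBound (α : Fin d → ℝ) (s c : ℝ) (x y : EuclideanSpace ℝ (Fin d)) :
    ∏ i, heatFactorBound (α i) s c (x i) (y i) =
      (∏ i, s ^ (-(1 + α i)) * (1 + x i * y i / s) ^ (-(α i + 1 / 2))) *
        Real.exp (-(‖x - y‖ ^ 2 / s / 2) - (c - 1) / (2 * s) * (‖x‖ ^ 2 + ‖y‖ ^ 2)) := by
  simp only [heatFactorBound]
  rw [Finset.prod_mul_distrib, ← Real.exp_sum]
  congr 2
  rw [EuclideanSpace.real_norm_sq_eq, EuclideanSpace.real_norm_sq_eq,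
    EuclideanSpace.real_norm_sq_eq, Finset.sum_sub_distrib, Finset.sum_neg_distrib,
    ← Finset.sum_add_distrib, ← Finset.mul_sum, div_div, Finset.sum_div, mul_comm s 2]
  rfl

/-- The extra factor 1 + r²/s + (c-1)(‖x‖² + ‖y‖²)/(2s) is room for the growth caused by r∇; the
exponentials absorb it at no cost. -/
lemma exists_prod_heatFactorBound_le {α : Fin d → ℝ} (hα : ∀ i, -(1 / 2) ≤ α i) :
    ∃ C : ℝ, 0 < C ∧ ∀ s c : ℝ, 0 < s → 1 ≤ c → ∀ x ∈ orthant d, ∀ y ∈ orthant d,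
      (∏ i, heatFactorBound (α i) s c (x i) (y i)) *
        (1 + ‖x - y‖ ^ 2 / s + (c - 1) / (2 * s) * (‖x‖ ^ 2 + ‖y‖ ^ 2)) ≤
      C * (shiftedWeight α x ‖x - y‖)⁻¹ *
        (s * (s + ‖x - y‖ ^ 2) ^ (-((d : ℝ) / 2 + 1))) := by
  set A : ℝ := ∑ i, (α i + 1 / 2)
  -- The exponent collects A from the prefactors, 1 from the growth factor 1 + u, and d/2 + 1 for
  -- the decay that is to remain.
  obtain ⟨C, hC, hb⟩ := exists_one_add_rpow_mul_exp_le (A + 1 + (d / 2 + 1))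
  refine ⟨4 ^ A * C, by positivity, fun s c hs hc x hx y hy => ?_⟩
  set r := ‖x - y‖
  have hr : 0 ≤ r := norm_nonneg _
  set u := r ^ 2 / s with hu
  have hu0 : 0 ≤ u := by positivity
  set P := (c - 1) / (2 * s) * (‖x‖ ^ 2 + ‖y‖ ^ 2)
  have hP : 0 ≤ P := by
    have : 0 ≤ c - 1 := by linarith
    positivity
  have hW := shiftedWeight_pos α hx hr
  have h1 : ∏ i, s ^ (-(1 + α i)) * (1 + x i * y i / s) ^ (-(α i + 1 / 2)) ≤
      4 ^ A * s ^ (-((d : ℝ) / 2)) * (shiftedWeight α x r)⁻¹ * (1 + u) ^ A := by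
    calc _ ≤ ∏ i, (4 ^ (α i + 1 / 2) * s ^ (-(1 / 2) : ℝ) * ((x i + r) ^ (2 * α i + 1))⁻¹ *
          (1 + r ^ 2 / s) ^ (α i + 1 / 2)) := by
          refine Finset.prod_le_prod (fun i _ => ?_) fun i _ =>
            heatFactorBound_prefactor_le (hα i) hs (hx i) (hy i) (abs_sub_apply_le x y i)
          have := hx i
          have := hy i
          positivity
      _ = _ := by
          rw [Finset.prod_mul_distrib, Finset.prod_mul_distrib, Finset.prod_mul_distrib,
            ← Real.rpow_sum_of_pos (by norm_num), ← Real.rpow_sum_of_pos hs,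
            ← Real.rpow_sum_of_pos (by positivity), Finset.sum_const, Finset.card_univ,
            Fintype.card_fin, nsmul_eq_mul, Finset.prod_inv_distrib, shiftedWeight]
          congr 4
          ring
  have h2 : Real.exp (-(u / 2) - P) * (1 + u + P) ≤ Real.exp (-(u / 2)) * (1 + u) := by
    have h3 : 1 + u + P ≤ (1 + u) * Real.exp P := by
      have := Real.add_one_le_exp P
      nlinarith [mul_nonneg hu0 hP]
    calc _ ≤ Real.exp (-(u / 2) - P) * ((1 + u) * Real.exp P) := by gcongr
      _ = (Real.exp (-(u / 2) - P) * Real.exp P) * (1 + u) := by ring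
      _ = _ := by rw [← Real.exp_add]; ring_nf
  have h4 : (1 + u) ^ A * (Real.exp (-(u / 2)) * (1 + u)) ≤
      C * (1 + u) ^ (-((d : ℝ) / 2 + 1)) := by
    have h5 := hb u hu0
    rw [Real.rpow_add (by positivity), Real.rpow_add_one (by positivity)] at h5
    rw [Real.rpow_neg (by positivity), ← div_eq_mul_inv, le_div_iff₀ (by positivity)]
    linarith
  have h6 : s ^ (-((d : ℝ) / 2)) * (1 + u) ^ (-((d : ℝ) / 2 + 1)) =
      s * (s + r ^ 2) ^ (-((d : ℝ) / 2 + 1)) := by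
    have : s + r ^ 2 = s * (1 + u) := by rw [hu]; field_simp
    rw [this, Real.mul_rpow hs.le (by positivity), ← mul_assoc]
    congr 1
    nth_rewrite 2 [← Real.rpow_one s]
    rw [← Real.rpow_add hs]
    ring_nf
  rw [prod_heatFactorBound]
  calc _ = (∏ i, s ^ (-(1 + α i)) * (1 + x i * y i / s) ^ (-(α i + 1 / 2))) *
        (Real.exp (-(u / 2) - P) * (1 + u + P)) := by ring
    _ ≤ (4 ^ A * s ^ (-((d : ℝ) / 2)) * (shiftedWeight α x r)⁻¹ * (1 + u) ^ A) *
        (Real.exp (-(u / 2)) * (1 + u)) := by gcongr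
    _ = 4 ^ A * s ^ (-((d : ℝ) / 2)) * (shiftedWeight α x r)⁻¹ *
        ((1 + u) ^ A * (Real.exp (-(u / 2)) * (1 + u))) := by ring
    _ ≤ 4 ^ A * s ^ (-((d : ℝ) / 2)) * (shiftedWeight α x r)⁻¹ *
        (C * (1 + u) ^ (-((d : ℝ) / 2 + 1))) := by gcongr
    _ = 4 ^ A * C * (shiftedWeight α x r)⁻¹ *
        (s ^ (-((d : ℝ) / 2)) * (1 + u) ^ (-((d : ℝ) / 2 + 1))) := by ring
    _ = _ := by rw [h6]

/-- The heat kernel as a product over the coordinates. -/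
def heatProd (α : Fin d → ℝ) (ε : Fin d → Fin 2) (s c : ℝ)
    (p : EuclideanSpace ℝ (Fin d) × EuclideanSpace ℝ (Fin d)) : ℝ :=
  ∏ i, heatFactor (α i) (ε i).val s c (p.1 i) (p.2 i)

/-- The coordinate `x_i` of a pair `(x, y)`. -/
def fstCoord (i : Fin d) : EuclideanSpace ℝ (Fin d) × EuclideanSpace ℝ (Fin d) →L[ℝ] ℝ :=
  (EuclideanSpace.proj i).comp (ContinuousLinearMap.fst ℝ _ _)

/-- The coordinate `y_i` of a pair `(x, y)`. -/
def sndCoord (i : Fin d) : EuclideanSpace ℝ (Fin d) × EuclideanSpace ℝ (Fin d) →L[ℝ] ℝ :=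
  (EuclideanSpace.proj i).comp (ContinuousLinearMap.snd ℝ _ _)

lemma norm_fstCoord_le (i : Fin d) : ‖fstCoord i‖ ≤ 1 :=
  ContinuousLinearMap.opNorm_le_bound _ zero_le_one fun v => by
    rw [one_mul]; exact (PiLp.norm_apply_le v.1 i).trans (norm_fst_le v)

lemma norm_sndCoord_le (i : Fin d) : ‖sndCoord i‖ ≤ 1 :=
  ContinuousLinearMap.opNorm_le_bound _ zero_le_one fun v => by
    rw [one_mul]; exact (PiLp.norm_apply_le v.2 i).trans (norm_snd_le v)

/-- The derivative of `heatProd`. -/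
def heatProdDeriv (α : Fin d → ℝ) (ε : Fin d → Fin 2) (s c : ℝ)
    (p : EuclideanSpace ℝ (Fin d) × EuclideanSpace ℝ (Fin d)) :
    EuclideanSpace ℝ (Fin d) × EuclideanSpace ℝ (Fin d) →L[ℝ] ℝ :=
  ∑ i, (∏ j ∈ Finset.univ.erase i, heatFactor (α j) (ε j).val s c (p.1 j) (p.2 j)) •
    (heatFactorDeriv (α i) (ε i).val s c (p.1 i) (p.2 i) • fstCoord i +
      heatFactorDeriv (α i) (ε i).val s c (p.2 i) (p.1 i) • sndCoord i)

lemma hasFDerivAt_heatProd {α : Fin d → ℝ} (hα : ∀ i, -(1 / 2) ≤ α i) (ε : Fin d → Fin 2)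
    (s c : ℝ) (p : EuclideanSpace ℝ (Fin d) × EuclideanSpace ℝ (Fin d)) :
    HasFDerivAt (heatProd α ε s c) (heatProdDeriv α ε s c p) p :=
  HasFDerivAt.finsetProd fun i _ => hasFDerivAt_heatFactor (hα i) (ε i).val s c
    (fstCoord i).hasFDerivAt (sndCoord i).hasFDerivAt

lemma mul_heatFactorDeriv_growth_le {s c : ℝ} (hs : 0 < s) (hc : 1 ≤ c)
    {x y : EuclideanSpace ℝ (Fin d)} (hx : x ∈ orthant d) (hy : y ∈ orthant d) (i : Fin d) :
    ‖x - y‖ * (y i / s / (1 + x i * y i / s) + |x i - y i| / s + (c - 1) / s * x i) ≤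
      3 * (1 + ‖x - y‖ ^ 2 / s + (c - 1) / (2 * s) * (‖x‖ ^ 2 + ‖y‖ ^ 2)) := by
  have h1 := div_div_one_add_le hs (hx i) (hy i) (abs_sub_apply_le x y i)
  have h2 : ‖x - y‖ * (|x i - y i| / s) ≤ ‖x - y‖ ^ 2 / s := by
    calc _ ≤ ‖x - y‖ * (‖x - y‖ / s) := by gcongr; exact abs_sub_apply_le x y i
      _ = _ := by ring
  have hxi : x i ≤ ‖x‖ := (le_abs_self _).trans (PiLp.norm_apply_le x i)
  have h3 : ‖x - y‖ * x i ≤ 3 / 2 * (‖x‖ ^ 2 + ‖y‖ ^ 2) := by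
    calc ‖x - y‖ * x i ≤ (‖x‖ + ‖y‖) * ‖x‖ :=
          mul_le_mul (norm_sub_le x y) hxi (hx i).le (by positivity)
      _ ≤ _ := by nlinarith [sq_nonneg (‖x‖ - ‖y‖), sq_nonneg ‖y‖]
  have hc1 : 0 ≤ (c - 1) / s := div_nonneg (by linarith) hs.le
  have h4 := mul_le_mul_of_nonneg_left h3 hc1
  have h5 : (c - 1) / (2 * s) = (c - 1) / s / 2 := by rw [div_div, mul_comm s]
  rw [h5]
  linarith

lemma exists_heatProd_le {α : Fin d → ℝ} (hα : ∀ i, -(1 / 2) ≤ α i) (ε : Fin d → Fin 2) :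
    ∃ C : ℝ, 0 < C ∧ ∀ s c : ℝ, 0 < s → 1 ≤ c → ∀ x ∈ orthant d, ∀ y ∈ orthant d,
      |heatProd α ε s c (x, y)| ≤ C * (shiftedWeight α x ‖x - y‖)⁻¹ *
        (s * (s + ‖x - y‖ ^ 2) ^ (-((d : ℝ) / 2 + 1))) ∧
      ‖x - y‖ * ‖heatProdDeriv α ε s c (x, y)‖ ≤ C * (shiftedWeight α x ‖x - y‖)⁻¹ *
        (s * (s + ‖x - y‖ ^ 2) ^ (-((d : ℝ) / 2 + 1))) := by
  choose K hK hfac using fun i => exists_heatFactor_le (hα i) (ε i).val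
  obtain ⟨C, hC, hb⟩ := exists_prod_heatFactorBound_le hα
  have hKp : 0 < ∏ i, K i := Finset.prod_pos fun i _ => hK i
  -- Each of the d coordinates contributes 3 from its x-derivative and 3 from its y-derivative; the
  -- 1 serves the bound without derivative.
  refine ⟨(1 + 6 * d) * (∏ i, K i) * C, by positivity, fun s c hs hc x hx y hy => ?_⟩
  specialize hb s c hs hc x hx y hy
  set r := ‖x - y‖ with hr
  set T := 1 + r ^ 2 / s + (c - 1) / (2 * s) * (‖x‖ ^ 2 + ‖y‖ ^ 2) with hT
  set R := s * (s + r ^ 2) ^ (-((d : ℝ) / 2 + 1))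
  have hT1 : 1 ≤ T := by
    have h1 : 0 ≤ (c - 1) / (2 * s) * (‖x‖ ^ 2 + ‖y‖ ^ 2) := by
      have : 0 ≤ c - 1 := by linarith
      positivity
    have h2 : 0 ≤ r ^ 2 / s := by positivity
    linarith
  set b : Fin d → ℝ := fun i => heatFactorBound (α i) s c (x i) (y i) with hbdef
  have hb0 : ∀ i, 0 ≤ b i := fun i => heatFactorBound_nonneg hs (hx i) (hy i)
  have hbp : 0 ≤ ∏ i, b i := Finset.prod_nonneg fun i _ => hb0 i
  have hq : ∀ i, |heatFactor (α i) (ε i).val s c (x i) (y i)| ≤ K i * b i := fun i =>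
    (hfac i s c (x i) (y i) hs hc (hx i) (hy i)).1
  have hKb : ∀ i, 0 ≤ K i * b i := fun i => mul_nonneg (hK i).le (hb0 i)
  have hCR : 0 ≤ C * (shiftedWeight α x r)⁻¹ * R := le_trans (by positivity) hb
  have hd : (0 : ℝ) ≤ d := Nat.cast_nonneg d
  constructor
  · calc |heatProd α ε s c (x, y)|
        = ∏ i, |heatFactor (α i) (ε i).val s c (x i) (y i)| := Finset.abs_prod _ _
      _ ≤ ∏ i, K i * b i := Finset.prod_le_prod (fun i _ => abs_nonneg _) fun i _ => hq i
      _ = (∏ i, K i) * ((∏ i, b i) * 1) := by rw [Finset.prod_mul_distrib, mul_one]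
      _ ≤ (∏ i, K i) * ((∏ i, b i) * T) := by gcongr
      _ ≤ (∏ i, K i) * (C * (shiftedWeight α x r)⁻¹ * R) := by gcongr
      _ = 1 * ((∏ i, K i) * (C * (shiftedWeight α x r)⁻¹ * R)) := (one_mul _).symm
      _ ≤ (1 + 6 * d) * ((∏ i, K i) * (C * (shiftedWeight α x r)⁻¹ * R)) := by
          gcongr; linarith
      _ = _ := by ring
  · have hterm : ∀ i, r * ‖(∏ j ∈ Finset.univ.erase i,
          heatFactor (α j) (ε j).val s c (x j) (y j)) •
        (heatFactorDeriv (α i) (ε i).val s c (x i) (y i) • fstCoord i +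
          heatFactorDeriv (α i) (ε i).val s c (y i) (x i) • sndCoord i)‖ ≤
        (∏ i, K i * b i) * (6 * T) := by
      intro i
      have hfst := norm_fstCoord_le i
      have hsnd := norm_sndCoord_le i
      have hx1 : r * |heatFactorDeriv (α i) (ε i).val s c (x i) (y i)| ≤ K i * b i * (3 * T) := by
        have h1 := (hfac i s c (x i) (y i) hs hc (hx i) (hy i)).2
        have h2 := mul_heatFactorDeriv_growth_le hs hc hx hy i
        calc _ ≤ r * (K i * b i * _) := by gcongr
          _ = K i * b i * (r * _) := by ring
          _ ≤ _ := mul_le_mul_of_nonneg_left h2 (hKb i)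
      have hy1 : r * |heatFactorDeriv (α i) (ε i).val s c (y i) (x i)| ≤ K i * b i * (3 * T) := by
        have h1 := (hfac i s c (y i) (x i) hs hc (hy i) (hx i)).2
        have h2 := mul_heatFactorDeriv_growth_le hs hc hy hx i
        rw [← heatFactorBound_comm] at h1
        rw [norm_sub_rev y x, ← hr, add_comm (‖y‖ ^ 2)] at h2
        calc _ ≤ r * (K i * b i * _) := by gcongr
          _ = K i * b i * (r * _) := by ring
          _ ≤ _ := mul_le_mul_of_nonneg_left h2 (hKb i)
      have hprod : |∏ j ∈ Finset.univ.erase i, heatFactor (α j) (ε j).val s c (x j) (y j)| ≤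
          ∏ j ∈ Finset.univ.erase i, K j * b j := by
        rw [Finset.abs_prod]
        exact Finset.prod_le_prod (fun i _ => abs_nonneg _) fun i _ => hq i
      rw [norm_smul, Real.norm_eq_abs, ← mul_assoc, mul_comm r, mul_assoc]
      calc _ ≤ (∏ j ∈ Finset.univ.erase i, K j * b j) * (r *
            (|heatFactorDeriv (α i) (ε i).val s c (x i) (y i)| * 1 +
              |heatFactorDeriv (α i) (ε i).val s c (y i) (x i)| * 1)) := by
            refine mul_le_mul hprod (mul_le_mul_of_nonneg_left ?_ (norm_nonneg _))
              (by positivity) (Finset.prod_nonneg fun j _ => hKb j)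
            refine (norm_add_le _ _).trans ?_
            rw [norm_smul, norm_smul, Real.norm_eq_abs, Real.norm_eq_abs]
            gcongr
        _ ≤ (∏ j ∈ Finset.univ.erase i, K j * b j) * (K i * b i * (6 * T)) := by
            refine mul_le_mul_of_nonneg_left ?_ (Finset.prod_nonneg fun j _ => hKb j)
            linarith
        _ = _ := by
            rw [← mul_assoc, Finset.prod_erase_mul _ _ (Finset.mem_univ i)]
    calc r * ‖heatProdDeriv α ε s c (x, y)‖ ≤ r * ∑ i, _ := by
          gcongr
          exact norm_sum_le _ _
      _ = ∑ i, r * _ := Finset.mul_sum _ _ _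
      _ ≤ ∑ _i : Fin d, (∏ i, K i * b i) * (6 * T) := Finset.sum_le_sum fun i _ => hterm i
      _ = 6 * d * ((∏ i, K i) * ((∏ i, b i) * T)) := by
          rw [Finset.sum_const, Finset.card_univ, Fintype.card_fin, nsmul_eq_mul,
            Finset.prod_mul_distrib]
          ring
      _ ≤ 6 * d * ((∏ i, K i) * (C * (shiftedWeight α x r)⁻¹ * R)) := by gcongr
      _ ≤ (1 + 6 * d) * ((∏ i, K i) * (C * (shiftedWeight α x r)⁻¹ * R)) := by
          gcongr; linarith
      _ = _ := by ring

/-! ### Integration in time. -/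

open MeasureTheory

lemma sinh_two_mul_pos {t : ℝ} (ht : 0 < t) : 0 < Real.sinh (2 * t) :=
  Real.sinh_pos_iff.mpr (by linarith)

/-- This lets s dt/t be replaced by ds; it holds because u cosh u - sinh u has derivative u sinh u ≥
0. -/
lemma sinh_div_le {t : ℝ} (ht : 0 < t) : Real.sinh (2 * t) / t ≤ 2 * Real.cosh (2 * t) := by
  rw [div_le_iff₀ ht]
  have hmono : MonotoneOn (fun u => u * Real.cosh u - Real.sinh u) (Set.Ici 0) := by
    refine monotoneOn_of_hasDerivWithinAt_nonneg (convex_Ici 0)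
      (f' := fun u => u * Real.sinh u) (by fun_prop) ?_ ?_
    · intro u _
      refine HasDerivAt.hasDerivWithinAt ?_
      refine (((hasDerivAt_id u).mul (Real.hasDerivAt_cosh u)).sub
        (Real.hasDerivAt_sinh u)).congr_deriv ?_
      simp
    · intro u hu
      have hu0 : 0 ≤ u := interior_subset hu
      exact mul_nonneg hu0 (Real.sinh_nonneg_iff.mpr hu0)
  have ht2 : (0 : ℝ) ≤ 2 * t := by linarith
  have := hmono Set.self_mem_Ici ht2 ht2
  simp only [zero_mul, Real.sinh_zero, sub_zero] at this
  linarith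

/-- The power z^{α+e} of the Bessel function cancels the denominator (xy)^{α+e}, leaving only powers
of s. -/
lemma heatKernel_factor {α : ℝ} (e : ℕ) {s x y : ℝ} (hs : 0 < s) (hx : 0 < x) (hy : 0 < y)
    (c : ℝ) :
    heatFactor α e s c x y = 1 / (2 * s) * Real.exp (-(1 / 2) * (c / s) * (x ^ 2 + y ^ 2)) *
      ((x * y) ^ e * (besselI (α + e) (x * y / s) / (x * y) ^ (α + e))) := by
  have hxy : 0 < x * y := by positivity
  rw [besselI_eq _ (by positivity), Real.div_rpow hxy.le hs.le, heatFactor,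
    show -(1 + α) = -1 + -α by ring, Real.rpow_add hs, Real.rpow_neg_one, Real.rpow_neg hs.le,
    Real.rpow_add hs, Real.rpow_natCast, div_pow]
  have h1 : (x * y) ^ (α + e) ≠ 0 := (Real.rpow_pos_of_pos hxy _).ne'
  have h2 : s ^ α ≠ 0 := (Real.rpow_pos_of_pos hs _).ne'
  field_simp

lemma heatKernel_eq_heatProd (α : Fin d → ℝ) (ε : Fin d → Fin 2) {t : ℝ} (ht : 0 < t)
    {x y : EuclideanSpace ℝ (Fin d)} (hx : x ∈ orthant d) (hy : y ∈ orthant d) :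
    heatKernel α ε t x y = heatProd α ε (Real.sinh (2 * t)) (Real.cosh (2 * t)) (x, y) := by
  rw [heatProd, Finset.prod_congr rfl fun i _ =>
    heatKernel_factor (ε i).val (sinh_two_mul_pos ht) (hx i) (hy i) _, Finset.prod_mul_distrib,
    Finset.prod_mul_distrib, ← Real.exp_sum, ← Finset.mul_sum, Finset.sum_add_distrib,
    ← EuclideanSpace.real_norm_sq_eq, ← EuclideanSpace.real_norm_sq_eq, Finset.prod_const,
    Finset.card_univ, Fintype.card_fin, heatKernel, one_div_pow]

/-- The time majorant `(sinh 2t + r²) ^ (-(d/2 + 1)) · 2 cosh 2t`. -/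
def timeMajorant (d : ℕ) (r t : ℝ) : ℝ :=
  (Real.sinh (2 * t) + r ^ 2) ^ (-((d : ℝ) / 2 + 1)) * (2 * Real.cosh (2 * t))

/-- The majorant is an exact derivative in t, and d > 0 makes its primitive vanish at infinity. -/
lemma timeMajorant_integral (hd : 0 < d) {r : ℝ} (hr : 0 < r) :
    IntegrableOn (timeMajorant d r) (Set.Ioi 0) ∧
      ∫ t in Set.Ioi 0, timeMajorant d r t = 2 / d * (r ^ d)⁻¹ := by
  have hd' : (0 : ℝ) < d := by exact_mod_cast hd
  set F : ℝ → ℝ := fun t => -(2 / d) * (Real.sinh (2 * t) + r ^ 2) ^ (-((d : ℝ) / 2)) with hF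
  have hder : ∀ t ∈ Set.Ici (0 : ℝ), HasDerivAt F (timeMajorant d r t) t := by
    intro t ht
    have hs : 0 ≤ Real.sinh (2 * t) := Real.sinh_nonneg_iff.mpr (mul_nonneg two_pos.le ht)
    have h1 : HasDerivAt (fun t : ℝ => Real.sinh (2 * t) + r ^ 2) (Real.cosh (2 * t) * 2) t := by
      have h0 : HasDerivAt (fun t : ℝ => 2 * t) 2 t := by
        simpa using (hasDerivAt_id t).const_mul 2
      exact h0.sinh.add_const _
    refine ((h1.rpow_const (p := -((d : ℝ) / 2)) (Or.inl (by positivity))).const_mul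
      (-(2 / d : ℝ))).congr_deriv ?_
    rw [timeMajorant, show -((d : ℝ) / 2) - 1 = -((d : ℝ) / 2 + 1) by ring]
    field_simp
  have hnonneg : ∀ t ∈ Set.Ioi (0 : ℝ), 0 ≤ timeMajorant d r t := by
    intro t ht
    have hs := sinh_two_mul_pos ht
    have := Real.cosh_pos (2 * t)
    unfold timeMajorant
    positivity
  have hlim : Filter.Tendsto F Filter.atTop (nhds 0) := by
    have h1 : Filter.Tendsto (fun t : ℝ => Real.sinh (2 * t) + r ^ 2) Filter.atTop
        Filter.atTop := by
      refine Filter.tendsto_atTop_mono' _ ?_ Filter.tendsto_id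
      filter_upwards [Filter.eventually_ge_atTop 0] with t ht
      have := Real.self_le_sinh_iff.mpr (mul_nonneg two_pos.le ht)
      simp only [id]
      nlinarith [sq_nonneg r]
    have h2 := ((tendsto_rpow_neg_atTop (show 0 < (d : ℝ) / 2 by positivity)).comp h1).const_mul
      (-(2 / d : ℝ))
    simpa [hF] using h2
  refine ⟨integrableOn_Ioi_deriv_of_nonneg' hder hnonneg hlim, ?_⟩
  rw [integral_Ioi_of_hasDerivAt_of_nonneg' hder hnonneg hlim, hF]
  simp only [mul_zero, Real.sinh_zero, zero_add, zero_sub, neg_mul, neg_neg]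
  congr 1
  rw [Real.rpow_neg (by positivity), ← Real.rpow_natCast r 2, ← Real.rpow_mul hr.le,
    ← Real.rpow_natCast r d]
  congr 2
  push_cast; ring

lemma norm_cpow_time {γ t : ℝ} (ht : 0 < t) : ‖(t : ℂ) ^ (Complex.I * (γ : ℂ) - 1)‖ = t⁻¹ := by
  rw [Complex.norm_cpow_eq_rpow_re_of_pos ht]
  simp [Real.rpow_neg_one]

lemma exists_heatProd_time_le {α : Fin d → ℝ} (hα : ∀ i, -(1 / 2) ≤ α i) (ε : Fin d → Fin 2) :
    ∃ C : ℝ, 0 < C ∧ ∀ t : ℝ, 0 < t → ∀ x ∈ orthant d, ∀ y ∈ orthant d, x ≠ y →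
      |heatProd α ε (Real.sinh (2 * t)) (Real.cosh (2 * t)) (x, y)| * t⁻¹ ≤
        C * (shiftedWeight α x ‖x - y‖)⁻¹ * timeMajorant d ‖x - y‖ t ∧
      ‖heatProdDeriv α ε (Real.sinh (2 * t)) (Real.cosh (2 * t)) (x, y)‖ * t⁻¹ ≤
        C * (‖x - y‖⁻¹ * (shiftedWeight α x ‖x - y‖)⁻¹) * timeMajorant d ‖x - y‖ t := by
  obtain ⟨C, hC, hb⟩ := exists_heatProd_le hα ε
  refine ⟨C, hC, fun t ht x hx y hy hxy => ?_⟩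
  have hs := sinh_two_mul_pos ht
  obtain ⟨h1, h2⟩ := hb _ _ hs (Real.one_le_cosh (2 * t)) x hx y hy
  have hr : 0 < ‖x - y‖ := norm_pos_iff.mpr (sub_ne_zero.mpr hxy)
  have hW := shiftedWeight_pos α hx hr.le
  set s := Real.sinh (2 * t)
  set r := ‖x - y‖
  have h3 : s * (s + r ^ 2) ^ (-((d : ℝ) / 2 + 1)) * t⁻¹ ≤ timeMajorant d r t := by
    calc _ = (s + r ^ 2) ^ (-((d : ℝ) / 2 + 1)) * (s / t) := by ring
      _ ≤ _ := mul_le_mul_of_nonneg_left (sinh_div_le ht) (by positivity)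
  constructor
  · calc _ ≤ C * (shiftedWeight α x r)⁻¹ * (s * (s + r ^ 2) ^ (-((d : ℝ) / 2 + 1))) * t⁻¹ := by
          gcongr
      _ = C * (shiftedWeight α x r)⁻¹ * (s * (s + r ^ 2) ^ (-((d : ℝ) / 2 + 1)) * t⁻¹) := by ring
      _ ≤ _ := by gcongr
  · set N := ‖heatProdDeriv α ε s (Real.cosh (2 * t)) (x, y)‖
    calc N * t⁻¹ = r⁻¹ * (r * N) * t⁻¹ := by field_simp
      _ ≤ r⁻¹ * (C * (shiftedWeight α x r)⁻¹ * (s * (s + r ^ 2) ^ (-((d : ℝ) / 2 + 1)))) *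
          t⁻¹ := by gcongr
      _ = C * (r⁻¹ * (shiftedWeight α x r)⁻¹) *
          (s * (s + r ^ 2) ^ (-((d : ℝ) / 2 + 1)) * t⁻¹) := by ring
      _ ≤ _ := by gcongr

/-! ### Weighted measure of balls. -/

lemma isOpen_orthant : IsOpen (orthant d) := by
  simp only [orthant, Set.ofPred_forall]
  exact isOpen_iInter_of_finite fun i =>
    isOpen_lt continuous_const (EuclideanSpace.proj (𝕜 := ℝ) i).continuous

lemma weightMeasure_orthantBall (α : Fin d → ℝ) (x : EuclideanSpace ℝ (Fin d)) (r : ℝ) :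
    weightMeasure α (orthantBall x r) =
      ∫⁻ z in orthantBall x r, ENNReal.ofReal (weight α z) := by
  have hmeas : MeasurableSet (orthantBall x r) :=
    (Metric.isOpen_ball.inter isOpen_orthant).measurableSet
  rw [weightMeasure, withDensity_apply _ hmeas, Measure.restrict_restrict hmeas,
    Set.inter_eq_left.mpr (show orthantBall x r ⊆ orthant d from Set.inter_subset_right)]

lemma weightMeasure_orthantBall_le {α : Fin d → ℝ} (hα : ∀ i, -(1 / 2) ≤ α i)
    {x : EuclideanSpace ℝ (Fin d)} (hx : x ∈ orthant d) {r : ℝ} (hr : 0 < r) :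
    weightMeasure α (orthantBall x r) ≤ ENNReal.ofReal
      ((volume : Measure (EuclideanSpace ℝ (Fin d))).real (Metric.ball 0 1) * r ^ d *
        shiftedWeight α x r) := by
  have hW := (shiftedWeight_pos α hx hr.le).le
  have hmeas : MeasurableSet (orthantBall x r) :=
    (Metric.isOpen_ball.inter isOpen_orthant).measurableSet
  have hle : ∀ z ∈ orthantBall x r, weight α z ≤ shiftedWeight α x r := by
    intro z hz
    refine Finset.prod_le_prod (fun i _ => by positivity) fun i _ => ?_
    refine Real.rpow_le_rpow (abs_nonneg _) ?_ (by linarith [hα i])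
    have h1 := abs_sub_apply_le z x i
    have h2 : ‖z - x‖ < r := by rw [← dist_eq_norm]; exact hz.1
    rw [abs_of_pos (hz.2 i)]
    linarith [(abs_le.mp h1).2]
  have hball : volume (Metric.ball x r) =
      ENNReal.ofReal (r ^ d) * volume (Metric.ball (0 : EuclideanSpace ℝ (Fin d)) 1) := by
    rw [Measure.addHaar_ball_of_pos _ _ hr, finrank_euclideanSpace_fin]
  rw [weightMeasure_orthantBall]
  calc ∫⁻ z in orthantBall x r, ENNReal.ofReal (weight α z)
      ≤ ∫⁻ _z in orthantBall x r, ENNReal.ofReal (shiftedWeight α x r) :=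
        setLIntegral_mono' hmeas fun z hz => ENNReal.ofReal_le_ofReal (hle z hz)
    _ = ENNReal.ofReal (shiftedWeight α x r) * volume (orthantBall x r) := by
        rw [setLIntegral_const]
    _ ≤ ENNReal.ofReal (shiftedWeight α x r) * volume (Metric.ball x r) := by
        gcongr; exact Set.inter_subset_left
    _ = _ := by
        rw [hball, ENNReal.ofReal_mul (by positivity), ENNReal.ofReal_mul (by positivity),
          measureReal_def, ENNReal.ofReal_toReal measure_ball_lt_top.ne]
        ring

/-- Positivity excludes the default 1/0 = 0, under which the target bound would be false or empty of
content. -/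
lemma weightMeasure_orthantBall_pos (α : Fin d → ℝ) {x : EuclideanSpace ℝ (Fin d)}
    (hx : x ∈ orthant d) {r : ℝ} (hr : 0 < r) : 0 < weightMeasure α (orthantBall x r) := by
  have hopen : IsOpen (orthantBall x r) := Metric.isOpen_ball.inter isOpen_orthant
  have hmeas : Measurable fun z : EuclideanSpace ℝ (Fin d) => ENNReal.ofReal (weight α z) := by
    unfold weight
    fun_prop
  rw [weightMeasure_orthantBall, setLIntegral_pos_iff hmeas]
  have hsub : orthantBall x r ⊆ Function.support fun z => ENNReal.ofReal (weight α z) := by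
    intro z hz
    have : 0 < weight α z :=
      Finset.prod_pos fun i _ => Real.rpow_pos_of_pos (abs_pos.mpr (hz.2 i).ne') _
    simpa using this
  rw [Set.inter_eq_right.mpr hsub]
  exact hopen.measure_pos _ ⟨x, Metric.mem_ball_self hr, hx⟩

lemma exists_inv_shiftedWeight_le {α : Fin d → ℝ} (hα : ∀ i, -(1 / 2) ≤ α i) :
    ∃ C : ℝ, 0 < C ∧ ∀ x ∈ orthant d, ∀ r : ℝ, 0 < r →
      (shiftedWeight α x r)⁻¹ * (r ^ d)⁻¹ ≤
        C * (1 / (weightMeasure α).real (orthantBall x r)) := by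
  have hv : 0 < (volume : Measure (EuclideanSpace ℝ (Fin d))).real (Metric.ball 0 1) :=
    ENNReal.toReal_pos (Metric.measure_ball_pos _ _ one_pos).ne' measure_ball_lt_top.ne
  refine ⟨_, hv, fun x hx r hr => ?_⟩
  have hle := weightMeasure_orthantBall_le hα hx hr
  have hW := shiftedWeight_pos α hx hr.le
  have hm : 0 < (weightMeasure α).real (orthantBall x r) :=
    ENNReal.toReal_pos (weightMeasure_orthantBall_pos α hx hr).ne'
      (hle.trans_lt ENNReal.ofReal_lt_top).ne
  have hle' : (weightMeasure α).real (orthantBall x r) ≤ _ :=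
    ENNReal.toReal_le_of_le_ofReal (by positivity) hle
  rw [mul_one_div, ← mul_inv, le_div_iff₀ hm, ← div_eq_inv_mul, div_le_iff₀ (by positivity)]
  refine hle'.trans_eq (by ring)

/-! ### Convergence and differentiation under the integral sign. -/

/-- The kernel integrand in product form, smooth in `p = (x, y)` on the whole space. -/
def prodIntegrand (α : Fin d → ℝ) (ε : Fin d → Fin 2) (γ : ℝ)
    (p : EuclideanSpace ℝ (Fin d) × EuclideanSpace ℝ (Fin d)) (t : ℝ) : ℂ :=
  (t : ℂ) ^ (Complex.I * (γ : ℂ) - 1) •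
    (heatProd α ε (Real.sinh (2 * t)) (Real.cosh (2 * t)) p : ℂ)

/-- The derivative of `prodIntegrand` in `p`. -/
def prodIntegrandDeriv (α : Fin d → ℝ) (ε : Fin d → Fin 2) (γ : ℝ)
    (p : EuclideanSpace ℝ (Fin d) × EuclideanSpace ℝ (Fin d)) (t : ℝ) :
    EuclideanSpace ℝ (Fin d) × EuclideanSpace ℝ (Fin d) →L[ℝ] ℂ :=
  (t : ℂ) ^ (Complex.I * (γ : ℂ) - 1) •
    Complex.ofRealCLM.comp (heatProdDeriv α ε (Real.sinh (2 * t)) (Real.cosh (2 * t)) p)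

lemma kernelIntegrand_eq (α : Fin d → ℝ) (ε : Fin d → Fin 2) (γ : ℝ) {t : ℝ} (ht : 0 < t)
    {x y : EuclideanSpace ℝ (Fin d)} (hx : x ∈ orthant d) (hy : y ∈ orthant d) :
    kernelIntegrand α ε γ x y t = prodIntegrand α ε γ (x, y) t := by
  rw [kernelIntegrand, heatKernel_eq_heatProd α ε ht hx hy, prodIntegrand, smul_eq_mul, mul_comm]

lemma hasFDerivAt_prodIntegrand {α : Fin d → ℝ} (hα : ∀ i, -(1 / 2) ≤ α i) (ε : Fin d → Fin 2)
    (γ t : ℝ) (p : EuclideanSpace ℝ (Fin d) × EuclideanSpace ℝ (Fin d)) :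
    HasFDerivAt (fun q => prodIntegrand α ε γ q t) (prodIntegrandDeriv α ε γ p t) p :=
  (Complex.ofRealCLM.hasFDerivAt.comp p (hasFDerivAt_heatProd hα ε (Real.sinh (2 * t))
    (Real.cosh (2 * t)) p)).const_smul ((t : ℂ) ^ (Complex.I * (γ : ℂ) - 1))

lemma measurable_heatFactor {α : ℝ} (hα : -(1 / 2) ≤ α) (e : ℕ) (x y : ℝ) :
    Measurable fun t : ℝ => heatFactor α e (Real.sinh (2 * t)) (Real.cosh (2 * t)) x y := by
  have he : (0 : ℝ) ≤ e := Nat.cast_nonneg e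
  have hE := (continuous_besselE (show -(1 / 2) ≤ α + e by linarith)).measurable
  unfold heatFactor
  fun_prop

lemma measurable_heatFactorDeriv {α : ℝ} (hα : -(1 / 2) ≤ α) (e : ℕ) (x y : ℝ) :
    Measurable fun t : ℝ => heatFactorDeriv α e (Real.sinh (2 * t)) (Real.cosh (2 * t)) x y := by
  have he : (0 : ℝ) ≤ e := Nat.cast_nonneg e
  have hE := (continuous_besselE (show -(1 / 2) ≤ α + e by linarith)).measurable
  have hE1 := (continuous_besselE (show -(1 / 2) ≤ α + e + 1 by linarith)).measurable
  unfold heatFactorDeriv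
  fun_prop

lemma measurable_prodIntegrand {α : Fin d → ℝ} (hα : ∀ i, -(1 / 2) ≤ α i) (ε : Fin d → Fin 2)
    (γ : ℝ) (p : EuclideanSpace ℝ (Fin d) × EuclideanSpace ℝ (Fin d)) :
    Measurable (prodIntegrand α ε γ p) := by
  have h1 : Measurable fun t : ℝ =>
      heatProd α ε (Real.sinh (2 * t)) (Real.cosh (2 * t)) p :=
    Finset.measurable_prod _ fun i _ => measurable_heatFactor (hα i) _ _ _
  unfold prodIntegrand
  fun_prop

lemma stronglyMeasurable_prodIntegrandDeriv {α : Fin d → ℝ} (hα : ∀ i, -(1 / 2) ≤ α i)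
    (ε : Fin d → Fin 2) (γ : ℝ) (p : EuclideanSpace ℝ (Fin d) × EuclideanSpace ℝ (Fin d)) :
    StronglyMeasurable (prodIntegrandDeriv α ε γ p) := by
  have h1 : StronglyMeasurable fun t : ℝ =>
      heatProdDeriv α ε (Real.sinh (2 * t)) (Real.cosh (2 * t)) p := by
    unfold heatProdDeriv
    refine Finset.stronglyMeasurable_fun_sum _ fun i _ => StronglyMeasurable.fun_smul ?_ ?_
    · exact (Finset.measurable_fun_prod _ fun j _ =>
        measurable_heatFactor (hα j) _ _ _).stronglyMeasurable
    · exact ((measurable_heatFactorDeriv (hα i) _ _ _).stronglyMeasurable.smul_const _).add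
        ((measurable_heatFactorDeriv (hα i) _ _ _).stronglyMeasurable.smul_const _)
  have h2 : Measurable fun t : ℝ => (t : ℂ) ^ (Complex.I * (γ : ℂ) - 1) := by fun_prop
  exact h2.stronglyMeasurable.smul
    ((continuous_const.clm_comp continuous_id).comp_stronglyMeasurable h1)

lemma norm_prodIntegrand (α : Fin d → ℝ) (ε : Fin d → Fin 2) (γ : ℝ) {t : ℝ} (ht : 0 < t)
    (p : EuclideanSpace ℝ (Fin d) × EuclideanSpace ℝ (Fin d)) :
    ‖prodIntegrand α ε γ p t‖ =
      |heatProd α ε (Real.sinh (2 * t)) (Real.cosh (2 * t)) p| * t⁻¹ := by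
  rw [prodIntegrand, norm_smul, norm_cpow_time ht, Complex.norm_real, Real.norm_eq_abs, mul_comm]

lemma norm_prodIntegrandDeriv_le (α : Fin d → ℝ) (ε : Fin d → Fin 2) (γ : ℝ) {t : ℝ} (ht : 0 < t)
    (p : EuclideanSpace ℝ (Fin d) × EuclideanSpace ℝ (Fin d)) :
    ‖prodIntegrandDeriv α ε γ p t‖ ≤
      ‖heatProdDeriv α ε (Real.sinh (2 * t)) (Real.cosh (2 * t)) p‖ * t⁻¹ := by
  rw [prodIntegrandDeriv, norm_smul, norm_cpow_time ht, mul_comm]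
  gcongr
  refine (ContinuousLinearMap.opNorm_comp_le _ _).trans ?_
  rw [Complex.ofRealCLM_norm, one_mul]

lemma timeMajorant_anti {ρ r t : ℝ} (hρ : 0 < ρ) (hr : ρ ≤ r) (ht : 0 < t) :
    timeMajorant d r t ≤ timeMajorant d ρ t := by
  have hs := sinh_two_mul_pos ht
  have hc := Real.cosh_pos (2 * t)
  have hd : (0 : ℝ) ≤ d := Nat.cast_nonneg d
  unfold timeMajorant
  gcongr ?_ * _
  exact Real.rpow_le_rpow_of_nonpos (by positivity) (by gcongr) (by linarith)

lemma shiftedWeight_ge {α : Fin d → ℝ} (hα : ∀ i, -(1 / 2) ≤ α i)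
    {x : EuclideanSpace ℝ (Fin d)} (hx : x ∈ orthant d) {ρ r : ℝ} (hρ : 0 < ρ) (hr : ρ ≤ r) :
    ∏ i, ρ ^ (2 * α i + 1) ≤ shiftedWeight α x r :=
  Finset.prod_le_prod (fun i _ => by positivity) fun i _ =>
    Real.rpow_le_rpow hρ.le (by linarith [hx i]) (by linarith [hα i])

lemma dim_pos_of_ne {x y : EuclideanSpace ℝ (Fin d)} (hxy : x ≠ y) : 0 < d := by
  rcases Nat.eq_zero_or_pos d with rfl | hd
  · exact absurd (Subsingleton.elim x y) hxy
  · exact hd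

lemma integrableOn_prodIntegrand {α : Fin d → ℝ} (hα : ∀ i, -(1 / 2) ≤ α i) (ε : Fin d → Fin 2)
    (γ : ℝ) {x y : EuclideanSpace ℝ (Fin d)} (hx : x ∈ orthant d) (hy : y ∈ orthant d)
    (hxy : x ≠ y) : IntegrableOn (prodIntegrand α ε γ (x, y)) (Set.Ioi 0) := by
  obtain ⟨C, -, hb⟩ := exists_heatProd_time_le hα ε
  have hr : 0 < ‖x - y‖ := norm_pos_iff.mpr (sub_ne_zero.mpr hxy)
  refine Integrable.mono' ((timeMajorant_integral (dim_pos_of_ne hxy) hr).1.const_mul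
    (C * (shiftedWeight α x ‖x - y‖)⁻¹))
    (measurable_prodIntegrand hα ε γ _).aestronglyMeasurable ?_
  filter_upwards [ae_restrict_mem measurableSet_Ioi] with t ht
  rw [norm_prodIntegrand α ε γ ht]
  exact (hb t ht x hx y hy hxy).1

lemma hasFDerivAt_integral_prodIntegrand {α : Fin d → ℝ} (hα : ∀ i, -(1 / 2) ≤ α i)
    (ε : Fin d → Fin 2) (γ : ℝ) {x y : EuclideanSpace ℝ (Fin d)} (hx : x ∈ orthant d)
    (hy : y ∈ orthant d) (hxy : x ≠ y) :
    HasFDerivAt (fun p => ∫ t in Set.Ioi (0 : ℝ), prodIntegrand α ε γ p t)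
      (∫ t in Set.Ioi (0 : ℝ), prodIntegrandDeriv α ε γ (x, y) t) (x, y) := by
  obtain ⟨C, hC, hb⟩ := exists_heatProd_time_le hα ε
  have hr : 0 < ‖x - y‖ := norm_pos_iff.mpr (sub_ne_zero.mpr hxy)
  -- On the open set where the points lie in the orthant at distance greater than ρ, both the time
  -- majorant and W⁻¹ are bounded by their values with ρ, independently of the point.
  set ρ := ‖x - y‖ / 2 with hρdef
  have hρ : 0 < ρ := by positivity
  set U : Set (EuclideanSpace ℝ (Fin d) × EuclideanSpace ℝ (Fin d)) :=
    (orthant d ×ˢ orthant d) ∩ {p | ρ < ‖p.1 - p.2‖}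
  have hU : IsOpen U := (isOpen_orthant.prod isOpen_orthant).inter
    (isOpen_lt continuous_const (by fun_prop))
  have hmem : (x, y) ∈ U := ⟨⟨hx, hy⟩, by simp only [Set.mem_ofPred_eq]; linarith⟩
  refine hasFDerivAt_integral_of_dominated_of_fderiv_le (hU.mem_nhds hmem)
    (bound := fun t => C * (ρ⁻¹ * (∏ i, ρ ^ (2 * α i + 1))⁻¹) * timeMajorant d ρ t)
    (Filter.Eventually.of_forall fun p => (measurable_prodIntegrand hα ε γ p).aestronglyMeasurable)
    (integrableOn_prodIntegrand hα ε γ hx hy hxy)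
    (stronglyMeasurable_prodIntegrandDeriv hα ε γ _).aestronglyMeasurable ?_
    ((timeMajorant_integral (dim_pos_of_ne hxy) hρ).1.const_mul _)
    (Filter.Eventually.of_forall fun t p _ => hasFDerivAt_prodIntegrand hα ε γ t p)
  filter_upwards [ae_restrict_mem measurableSet_Ioi] with t ht p hp
  obtain ⟨⟨hp1, hp2⟩, hp3⟩ := hp
  have hp3' : ρ ≤ ‖p.1 - p.2‖ := le_of_lt hp3
  have hne : p.1 ≠ p.2 := sub_ne_zero.mp (norm_pos_iff.mp (hρ.trans_le hp3'))
  have hprod : 0 < ∏ i, ρ ^ (2 * α i + 1) := Finset.prod_pos fun i _ => by positivity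
  have hW := shiftedWeight_pos α hp1 (norm_nonneg (p.1 - p.2))
  refine (norm_prodIntegrandDeriv_le α ε γ ht p).trans
    ((hb t ht p.1 hp1 p.2 hp2 hne).2.trans ?_)
  have h1 := shiftedWeight_ge hα hp1 hρ hp3'
  have h2 : 0 ≤ timeMajorant d ‖p.1 - p.2‖ t := by
    have hs := sinh_two_mul_pos ht
    have hc := Real.cosh_pos (2 * t)
    unfold timeMajorant
    positivity
  have h3 := timeMajorant_anti (d := d) hρ hp3' ht
  gcongr

lemma norm_integral_le_timeMajorant {E : Type*} [NormedAddCommGroup E] [NormedSpace ℝ E]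
    (hd : 0 < d) {r K : ℝ} (hr : 0 < r) {f : ℝ → E}
    (hf : ∀ t, 0 < t → ‖f t‖ ≤ K * timeMajorant d r t) :
    ‖∫ t in Set.Ioi (0 : ℝ), f t‖ ≤ K * (2 / d * (r ^ d)⁻¹) := by
  obtain ⟨hint, hval⟩ := timeMajorant_integral hd hr
  rw [← hval, ← integral_const_mul]
  refine norm_integral_le_of_norm_le (hint.const_mul K) ?_
  filter_upwards [ae_restrict_mem measurableSet_Ioi] with t ht using hf t ht

lemma kernel_eq (α : Fin d → ℝ) (ε : Fin d → Fin 2) (γ : ℝ)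
    {x y : EuclideanSpace ℝ (Fin d)} (hx : x ∈ orthant d) (hy : y ∈ orthant d) :
    kernel α ε γ x y = 1 / Complex.Gamma (Complex.I * (γ : ℂ)) *
      ∫ t in Set.Ioi (0 : ℝ), prodIntegrand α ε γ (x, y) t := by
  rw [kernel]
  congr 1
  exact setIntegral_congr_fun measurableSet_Ioi fun t ht => kernelIntegrand_eq α ε γ ht hx hy

lemma hasFDerivAt_kernel {α : Fin d → ℝ} (hα : ∀ i, -(1 / 2) ≤ α i)
    (ε : Fin d → Fin 2) (γ : ℝ) {x y : EuclideanSpace ℝ (Fin d)} (hx : x ∈ orthant d)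
    (hy : y ∈ orthant d) (hxy : x ≠ y) :
    HasFDerivAt (Function.uncurry (kernel α ε γ))
      ((1 / Complex.Gamma (Complex.I * (γ : ℂ))) •
        ∫ t in Set.Ioi (0 : ℝ), prodIntegrandDeriv α ε γ (x, y) t) (x, y) := by
  refine ((hasFDerivAt_integral_prodIntegrand hα ε γ hx hy hxy).const_smul
    (1 / Complex.Gamma (Complex.I * (γ : ℂ)))).congr_of_eventuallyEq ?_
  filter_upwards [(isOpen_orthant.prod isOpen_orthant).mem_nhds
    (show (x, y) ∈ orthant d ×ˢ orthant d from ⟨hx, hy⟩)] with p hp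
  exact kernel_eq α ε γ hp.1 hp.2

/-! ### Gradient norm and conclusion. -/

lemma gradNorm_le {F : EuclideanSpace ℝ (Fin d) → EuclideanSpace ℝ (Fin d) → ℂ}
    (x y : EuclideanSpace ℝ (Fin d)) :
    gradNorm F x y ≤ Real.sqrt (2 * d) * ‖fderiv ℝ (Function.uncurry F) (x, y)‖ := by
  set L := fderiv ℝ (Function.uncurry F) (x, y)
  have h1 : ∀ i : Fin d, ‖L (EuclideanSpace.single i 1, 0)‖ ^ 2 ≤ ‖L‖ ^ 2 := fun i => by
    gcongr
    simpa [Prod.norm_def] using L.le_opNorm (EuclideanSpace.single i 1, 0)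
  have h2 : ∀ i : Fin d, ‖L (0, EuclideanSpace.single i 1)‖ ^ 2 ≤ ‖L‖ ^ 2 := fun i => by
    gcongr
    simpa [Prod.norm_def] using L.le_opNorm (0, EuclideanSpace.single i 1)
  have h3 : ∑ i, ‖L (EuclideanSpace.single i 1, 0)‖ ^ 2 +
      ∑ i, ‖L (0, EuclideanSpace.single i 1)‖ ^ 2 ≤ 2 * d * ‖L‖ ^ 2 := by
    refine (add_le_add (Finset.sum_le_sum fun i _ => h1 i)
      (Finset.sum_le_sum fun i _ => h2 i)).trans_eq ?_
    simp; ring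
  refine (Real.sqrt_le_sqrt h3).trans_eq ?_
  rw [Real.sqrt_mul (by positivity), Real.sqrt_sq (norm_nonneg _)]

end

end DunklHermite

theorem theorem3p4 {d : ℕ} (α : Fin d → ℝ) (hα : ∀ i, -(1 / 2 : ℝ) ≤ α i)
    (ε : Fin d → Fin 2) (γ : ℝ) (hγ : γ ≠ 0) :
    (∀ x ∈ DunklHermite.orthant d, ∀ y ∈ DunklHermite.orthant d, x ≠ y →
      MeasureTheory.IntegrableOn (DunklHermite.kernelIntegrand α ε γ x y) (Set.Ioi (0 : ℝ))) ∧
    (∃ C : ℝ, 0 < C ∧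
      ∀ x ∈ DunklHermite.orthant d, ∀ y ∈ DunklHermite.orthant d, x ≠ y →
        ‖DunklHermite.kernel α ε γ x y‖ ≤
          C * (1 / (DunklHermite.weightMeasure α).real (DunklHermite.orthantBall x ‖y - x‖))) ∧
    (∃ C : ℝ, 0 < C ∧
      ∀ x ∈ DunklHermite.orthant d, ∀ y ∈ DunklHermite.orthant d, x ≠ y →
        DifferentiableAt ℝ (Function.uncurry (DunklHermite.kernel α ε γ)) (x, y) ∧
        DunklHermite.gradNorm (DunklHermite.kernel α ε γ) x y ≤
          C * (1 / ‖x - y‖ *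
            (1 / (DunklHermite.weightMeasure α).real
              (DunklHermite.orthantBall x ‖y - x‖)))) := by
  obtain ⟨C, hC, hb⟩ := DunklHermite.exists_heatProd_time_le hα ε
  obtain ⟨V, hV, hvol⟩ := DunklHermite.exists_inv_shiftedWeight_le hα
  have hg : 0 < ‖1 / Complex.Gamma (Complex.I * (γ : ℂ))‖ := by
    refine norm_pos_iff.mpr (one_div_ne_zero (Complex.Gamma_ne_zero fun m hm => hγ ?_))
    -- The number iγ is not a pole of Γ, its imaginary part γ being nonzero.
    simpa using congrArg Complex.im hm
  set g := ‖1 / Complex.Gamma (Complex.I * (γ : ℂ))‖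
  have hsq : 0 ≤ Real.sqrt (2 * d) := Real.sqrt_nonneg _
  -- The summand 1 beside √(2d) keeps the constant positive when d = 0, where the bounds are
  -- vacuous.
  refine ⟨fun x hx y hy hxy => ?_, ⟨g * C * 2 * V, by positivity, fun x hx y hy hxy => ?_⟩,
    ⟨(Real.sqrt (2 * d) + 1) * (g * C * 2 * V), by positivity, fun x hx y hy hxy => ?_⟩⟩
  · exact (DunklHermite.integrableOn_prodIntegrand hα ε γ hx hy hxy).congr_fun
      (fun t ht => (DunklHermite.kernelIntegrand_eq α ε γ ht hx hy).symm) measurableSet_Ioi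
  · have hd := DunklHermite.dim_pos_of_ne hxy
    have hd1 : (1 : ℝ) ≤ d := by exact_mod_cast hd
    have hr : 0 < ‖x - y‖ := norm_pos_iff.mpr (sub_ne_zero.mpr hxy)
    have hW := DunklHermite.shiftedWeight_pos α hx hr.le
    have h := DunklHermite.norm_integral_le_timeMajorant hd hr fun t ht =>
      (DunklHermite.norm_prodIntegrand α ε γ ht (x, y)).trans_le (hb t ht x hx y hy hxy).1
    have h2 : (2 : ℝ) / d ≤ 2 := div_le_self two_pos.le hd1
    rw [DunklHermite.kernel_eq α ε γ hx hy, norm_mul, norm_sub_rev y x]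
    set W := DunklHermite.shiftedWeight α x ‖x - y‖
    calc _ ≤ g * (C * W⁻¹ * (2 / d * (‖x - y‖ ^ d)⁻¹)) := by gcongr
      _ ≤ g * (C * W⁻¹ * (2 * (‖x - y‖ ^ d)⁻¹)) := by gcongr
      _ = g * C * 2 * (W⁻¹ * (‖x - y‖ ^ d)⁻¹) := by ring
      _ ≤ g * C * 2 * (V * _) := mul_le_mul_of_nonneg_left (hvol x hx _ hr) (by positivity)
      _ = _ := by ring
  · have hder := DunklHermite.hasFDerivAt_kernel hα ε γ hx hy hxy
    refine ⟨hder.differentiableAt, (DunklHermite.gradNorm_le x y).trans ?_⟩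
    have hd := DunklHermite.dim_pos_of_ne hxy
    have hd1 : (1 : ℝ) ≤ d := by exact_mod_cast hd
    have hr : 0 < ‖x - y‖ := norm_pos_iff.mpr (sub_ne_zero.mpr hxy)
    have hW := DunklHermite.shiftedWeight_pos α hx hr.le
    have h := DunklHermite.norm_integral_le_timeMajorant hd hr fun t ht =>
      (DunklHermite.norm_prodIntegrandDeriv_le α ε γ ht (x, y)).trans (hb t ht x hx y hy hxy).2
    have h2 : (2 : ℝ) / d ≤ 2 := div_le_self two_pos.le hd1
    rw [hder.fderiv, norm_smul, norm_sub_rev y x, one_div ‖x - y‖]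
    set W := DunklHermite.shiftedWeight α x ‖x - y‖
    set r := ‖x - y‖
    calc _ ≤ (Real.sqrt (2 * d) + 1) * (g * (C * (r⁻¹ * W⁻¹) * (2 / d * (r ^ d)⁻¹))) := by
          gcongr; linarith
      _ ≤ (Real.sqrt (2 * d) + 1) * (g * (C * (r⁻¹ * W⁻¹) * (2 * (r ^ d)⁻¹))) := by gcongr
      _ = (Real.sqrt (2 * d) + 1) * (g * C * 2) * r⁻¹ * (W⁻¹ * (r ^ d)⁻¹) := by ring
      _ ≤ (Real.sqrt (2 * d) + 1) * (g * C * 2) * r⁻¹ * (V * _) :=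
          mul_le_mul_of_nonneg_left (hvol x hx _ hr) (by positivity)
      _ = _ := by ring
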